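/- Let $\Phi$ be a commutative associative ring with $1$ in which $2$ is invertible. By an algebra we mean a (not necessarily associative or unital) $\Phi$-algebra; ideals are two-sided and are $\Phi$-submodules. A noncommutative Jordan algebra is an algebra satisfying $(x,y,x)=0$ and $(x^2,y,x)=0$, where $(a,b,c)=(ab)c-a(bc)$. For an algebra $A$ and $n\ge 1$, $A^n$ is the $\Phi$-submodule spanned by all products of $n$ elements of $A$ with all arrangements of parentheses; $A$ is nilpotent if $A^n=0$ for some $n\ge 1$, and locally nilpotent if all its finitely generated subalgebras are nilpotent. A variety $\mathcal V$ is the class of all algebras satisfying a given set of identities (with coefficients in $\Phi$, in countably many variables). It is homogeneous if, with every identity $f=0$ of $\mathcal V$, each homogeneous component of $f$ (the sum of its terms of a given degree) is also an identity of $\mathcal V$. A variety of noncommutative Jordan algebras is locally admissible if every anticommutative algebra in it is locally nilpotent. Let $Z$ be an ideal of $\Phi$. A finitely generated algebra $A$ is finite over $Z$ (in Shirshov's sense) if there are $m\ge 1$ and $a_1,\dots,a_n\in A$ with $A^m\subseteq Za_1+\cdots+Za_n$. An algebra is locally finite over $Z$ if each of its finitely generated subalgebras is finite over $Z$. For a property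 $\mathcal P$ of algebras we say that the $\mathcal P$-radical exists in $\mathcal V$ if: (a) every homomorphic image of an algebra of $\mathcal V$ with property $\mathcal P$ has property $\mathcal P$; (b) every algebra $A\in\mathcal V$ has an ideal $R=\mathcal P(A)$ that has property $\mathcal P$ (as an algebra) and contains every ideal of $A$ with property $\mathcal P$; (c) the quotient algebra $A/\mathcal P(A)$ has no nonzero ideals with property $\mathcal P$. **Theorem.** Let $\mathcal V$ be a homogeneous locally admissible variety of noncommutative Jordan algebras over $\Phi$. Then, for every ideal $Z$ of $\Phi$, the locally finite over $Z$ radical exists in $\mathcal V$. In particular, the locally nilpotent radical exists in $\mathcal V$, and so does the locally finite radical, where an algebra is called locally finite if each of its finitely generated subalgebras is a finitely generated $\Phi$-module (that is, finite-dimensional if $\Phi$ is a field). -/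

import Mathlib

universe u

/-! Throughout, an algebra over a commutative ring `Φ` is a (not necessarily associative, not
necessarily unital) `Φ`-algebra: a `NonUnitalNonAssocRing` which is a `Φ`-module with a bilinear
product (`IsScalarTower Φ A A`, `SMulCommClass Φ A A`). -/

namespace ShirshovRadical

section Algebras

variable (Φ : Type u) [CommRing Φ]
variable (A : Type u) [NonUnitalNonAssocRing A] [Module Φ A]
  [IsScalarTower Φ A A] [SMulCommClass Φ A A]

/-- The power `A ^ n` (for `n ≥ 1`): the `Φ`-submodule of `A` spanned by all products of `n`
elements of `A`, with all arrangements of parentheses. -/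
def power (n : ℕ) : Submodule Φ A :=
  Submodule.span Φ {x | ∃ w : FreeMagma A, w.length = n ∧ FreeMagma.lift (id : A → A) w = x}

/-- `A` is finitely generated as a `Φ`-algebra. -/
def IsFinGen : Prop :=
  ∃ S : Set A, S.Finite ∧ NonUnitalAlgebra.adjoin Φ S = ⊤

/-- `A` is nilpotent: `A ^ n = 0` for some `n ≥ 1`. -/
def IsNilpotentAlg : Prop :=
  ∃ n : ℕ, 1 ≤ n ∧ power Φ A n = ⊥

/-- `A` is locally nilpotent: every finitely generated subalgebra is nilpotent. -/
def IsLocallyNilpotentAlg : Prop :=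
  ∀ B : NonUnitalSubalgebra Φ A, IsFinGen Φ B → IsNilpotentAlg Φ B

/-- `A` is finite over the ideal `Z` of `Φ` (in Shirshov's sense): it is finitely generated and
`A ^ m ⊆ Z a₁ + ⋯ + Z aₙ` for some `m ≥ 1` and some `a₁, …, aₙ ∈ A`. -/
def IsFiniteOver (Z : Ideal Φ) : Prop :=
  IsFinGen Φ A ∧ ∃ m : ℕ, 1 ≤ m ∧ ∃ (n : ℕ) (a : Fin n → A),
    ∀ x ∈ power Φ A m, ∃ z : Fin n → Φ, (∀ i, z i ∈ Z) ∧ x = ∑ i, z i • a i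

/-- `A` is locally finite over `Z`: every finitely generated subalgebra is finite over `Z`. -/
def IsLocallyFiniteOver (Z : Ideal Φ) : Prop :=
  ∀ B : NonUnitalSubalgebra Φ A, IsFinGen Φ B → IsFiniteOver Φ B Z

/-- `A` is locally finite: every finitely generated subalgebra is finitely generated as a
`Φ`-module (finite-dimensional, when `Φ` is a field). -/
def IsLocallyFiniteAlg : Prop :=
  ∀ B : NonUnitalSubalgebra Φ A, IsFinGen Φ B → Module.Finite Φ B

end Algebras

section Identities

variable (A : Type u) [NonUnitalNonAssocRing A]

/-- Noncommutative Jordan algebras: the identities `(x, y, x) = 0` and `(x², y, x) = 0`. -/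
def IsNoncommJordan : Prop :=
  (∀ x y : A, associator x y x = 0) ∧ ∀ x y : A, associator (x * x) y x = 0

/-- Anticommutative algebras. -/
def IsAnticomm : Prop :=
  ∀ x y : A, x * y = -(y * x)

end Identities

section Ideals

variable (Φ : Type u) [CommRing Φ]
variable (A : Type u) [NonUnitalNonAssocRing A] [Module Φ A]

/-- Two-sided ideals of a `Φ`-algebra (as is usual, they are `Φ`-submodules). An ideal is
in particular a subalgebra, and so is itself a `Φ`-algebra. -/
structure AlgIdeal extends NonUnitalSubalgebra Φ A where
  mul_mem_left : ∀ a x : A, x ∈ carrier → a * x ∈ carrier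
  mul_mem_right : ∀ x a : A, x ∈ carrier → x * a ∈ carrier

variable {Φ A}

/-- The quotient algebra `A / I`. -/
def AlgIdeal.Quot (I : AlgIdeal Φ A) : Type u :=
  A ⧸ I.toNonUnitalSubalgebra.toSubmodule

namespace AlgIdeal

variable (I : AlgIdeal Φ A)

instance : AddCommGroup I.Quot :=
  inferInstanceAs (AddCommGroup (A ⧸ I.toNonUnitalSubalgebra.toSubmodule))

instance : Module Φ I.Quot :=
  inferInstanceAs (Module Φ (A ⧸ I.toNonUnitalSubalgebra.toSubmodule))

/-- The canonical projection `A → A / I`. -/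
def proj : A →ₗ[Φ] I.Quot :=
  Submodule.mkQ I.toNonUnitalSubalgebra.toSubmodule

theorem proj_surjective : Function.Surjective I.proj :=
  Submodule.mkQ_surjective _

theorem proj_eq_proj {a b : A} : I.proj a = I.proj b ↔ a - b ∈ I.toNonUnitalSubalgebra :=
  Submodule.Quotient.eq _

/-- The product of `A / I` is the one induced by the product of `A`. -/
instance : Mul I.Quot where
  mul := Quotient.map₂ (fun a b : A => a * b) (by
    intro a a' ha b b' hb
    have ha' : a - a' ∈ I.toNonUnitalSubalgebra := (Submodule.quotientRel_def _).1 ha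
    have hb' : b - b' ∈ I.toNonUnitalSubalgebra := (Submodule.quotientRel_def _).1 hb
    refine (Submodule.quotientRel_def _).2 ?_
    have h : a * b - a' * b' = (a - a') * b + a' * (b - b') := by
      rw [sub_mul, mul_sub]; abel
    have h2 : (a - a') * b + a' * (b - b') ∈ I.toNonUnitalSubalgebra :=
      add_mem (I.mul_mem_right _ _ ha') (I.mul_mem_left _ _ hb')
    rw [h]
    exact h2)

theorem proj_mul (a b : A) : I.proj (a * b) = I.proj a * I.proj b := rfl

instance : NonUnitalNonAssocRing I.Quot where
  left_distrib x y z := by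
    obtain ⟨a, rfl⟩ := I.proj_surjective x
    obtain ⟨b, rfl⟩ := I.proj_surjective y
    obtain ⟨c, rfl⟩ := I.proj_surjective z
    rw [← map_add, ← proj_mul, ← proj_mul, ← proj_mul, mul_add, map_add]
  right_distrib x y z := by
    obtain ⟨a, rfl⟩ := I.proj_surjective x
    obtain ⟨b, rfl⟩ := I.proj_surjective y
    obtain ⟨c, rfl⟩ := I.proj_surjective z
    rw [← map_add, ← proj_mul, ← proj_mul, ← proj_mul, add_mul, map_add]
  zero_mul x := by
    obtain ⟨a, rfl⟩ := I.proj_surjective x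
    rw [← map_zero I.proj, ← proj_mul, zero_mul]
  mul_zero x := by
    obtain ⟨a, rfl⟩ := I.proj_surjective x
    rw [← map_zero I.proj, ← proj_mul, mul_zero]

instance [IsScalarTower Φ A A] : IsScalarTower Φ I.Quot I.Quot where
  smul_assoc r x y := by
    obtain ⟨a, rfl⟩ := I.proj_surjective x
    obtain ⟨b, rfl⟩ := I.proj_surjective y
    rw [smul_eq_mul, smul_eq_mul, ← map_smul, ← proj_mul, ← proj_mul, ← map_smul, smul_mul_assoc]

instance [SMulCommClass Φ A A] : SMulCommClass Φ I.Quot I.Quot where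
  smul_comm r x y := by
    obtain ⟨a, rfl⟩ := I.proj_surjective x
    obtain ⟨b, rfl⟩ := I.proj_surjective y
    rw [smul_eq_mul, smul_eq_mul, ← map_smul, ← proj_mul, ← proj_mul, ← map_smul, mul_smul_comm]

end AlgIdeal

end Ideals

section Varieties

variable {Φ : Type u} [CommRing Φ]

/-- The algebra `A` satisfies the identity `f = 0`, where `f` is a nonassociative polynomial in
countably many variables: every substitution of elements of `A` for the variables sends `f`
to `0`. -/
def Satisfies (A : Type u) [NonUnitalNonAssocRing A] [Module Φ A]
    [IsScalarTower Φ A A] [SMulCommClass Φ A A]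
    (f : FreeNonUnitalNonAssocAlgebra Φ ℕ) : Prop :=
  ∀ v : ℕ → A, FreeNonUnitalNonAssocAlgebra.lift Φ v f = 0

/-- The algebra `A` belongs to the variety of `Φ`-algebras defined by the set `E` of identities. -/
def InVariety (E : Set (FreeNonUnitalNonAssocAlgebra Φ ℕ))
    (A : Type u) [NonUnitalNonAssocRing A] [Module Φ A]
    [IsScalarTower Φ A A] [SMulCommClass Φ A A] : Prop :=
  ∀ f ∈ E, Satisfies A f

/-- `f = 0` is an identity of the variety defined by `E`: it holds in all its algebras. -/
def IsIdentityOf (E : Set (FreeNonUnitalNonAssocAlgebra Φ ℕ))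
    (f : FreeNonUnitalNonAssocAlgebra Φ ℕ) : Prop :=
  ∀ (A : Type u) [NonUnitalNonAssocRing A] [Module Φ A]
    [IsScalarTower Φ A A] [SMulCommClass Φ A A], InVariety E A → Satisfies A f

/-- The homogeneous component of (total) degree `d` of a nonassociative polynomial: the part
formed by its monomials of length `d`. -/
noncomputable def homogComponent (d : ℕ) (f : FreeNonUnitalNonAssocAlgebra Φ ℕ) :
    FreeNonUnitalNonAssocAlgebra Φ ℕ :=
  MonoidAlgebra.ofCoeff (f.coeff.filter fun w => w.length = d)

/-- The variety defined by `E` is homogeneous: with every identity `f`, all the homogeneous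
components of `f` are identities of the variety. (Components are taken here for the total degree.
Each of them is the sum of finer components, of given degree in every variable; so a variety which
is homogeneous with respect to the degrees in all the variables is homogeneous in this sense.) -/
def IsHomogeneousVariety (E : Set (FreeNonUnitalNonAssocAlgebra Φ ℕ)) : Prop :=
  ∀ f, IsIdentityOf E f → ∀ d : ℕ, IsIdentityOf E (homogComponent d f)

/-- The variety defined by `E` is a variety of noncommutative Jordan algebras. -/
def IsNoncommJordanVariety (E : Set (FreeNonUnitalNonAssocAlgebra Φ ℕ)) : Prop :=
  ∀ (A : Type u) [NonUnitalNonAssocRing A] [Module Φ A]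
    [IsScalarTower Φ A A] [SMulCommClass Φ A A], InVariety E A → IsNoncommJordan A

/-- A variety of noncommutative Jordan algebras is locally admissible if all its anticommutative
algebras are locally nilpotent. -/
def IsLocallyAdmissible (E : Set (FreeNonUnitalNonAssocAlgebra Φ ℕ)) : Prop :=
  IsNoncommJordanVariety E ∧
  ∀ (A : Type u) [NonUnitalNonAssocRing A] [Module Φ A]
    [IsScalarTower Φ A A] [SMulCommClass Φ A A],
    InVariety E A → IsAnticomm A → IsLocallyNilpotentAlg Φ A

/-- The `P`-radical exists in the variety defined by `E`, i.e. the property `P` of algebras is a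
radical property there (in the sense of Amitsur and Kurosh):
homomorphic images of `P`-algebras of the variety are `P`-algebras, every algebra `A` of the
variety has a greatest `P`-ideal `R`, and `A / R` has no nonzero `P`-ideals. -/
def RadicalExists (E : Set (FreeNonUnitalNonAssocAlgebra Φ ℕ))
    (P : ∀ (A : Type u) [NonUnitalNonAssocRing A] [Module Φ A]
      [IsScalarTower Φ A A] [SMulCommClass Φ A A], Prop) : Prop :=
  (∀ (A : Type u) [NonUnitalNonAssocRing A] [Module Φ A]
      [IsScalarTower Φ A A] [SMulCommClass Φ A A]
      (B : Type u) [NonUnitalNonAssocRing B] [Module Φ B]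
      [IsScalarTower Φ B B] [SMulCommClass Φ B B] (π : A →ₙₐ[Φ] B),
      InVariety E A → Function.Surjective π → P A → P B) ∧
  ∀ (A : Type u) [NonUnitalNonAssocRing A] [Module Φ A]
    [IsScalarTower Φ A A] [SMulCommClass Φ A A], InVariety E A →
    ∃ R : AlgIdeal Φ A,
      P R.toNonUnitalSubalgebra ∧
      (∀ I : AlgIdeal Φ A, P I.toNonUnitalSubalgebra →
        I.toNonUnitalSubalgebra ≤ R.toNonUnitalSubalgebra) ∧
      ∀ J : AlgIdeal Φ R.Quot, P J.toNonUnitalSubalgebra → J.toNonUnitalSubalgebra = ⊥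

end Varieties

end ShirshovRadical

/-! Everything reduces to an extension property: a finite family generates a subalgebra finite over
`Z` as soon as its image under a homomorphism does and all finite families in the kernel do
(`IsFiniteFamily.of_extension`). Given this, sums of two locally finite ideals are locally finite,
the union of all such ideals is the greatest one, and the quotient by it has no nonzero one left.
Local nilpotency and local finiteness are the cases `Z = ⊥` and `Z = ⊤`.

The extension property rests on a splitting of long words (`exists_lift_mem_splitWords`): a long
word is a combination of words of the same length that are products of two factors of length at
least 2. To obtain it, consider the Jordan product xy + yx. Its square D is an ideal of the original
algebra with anticommutative quotient, so local admissibility puts long words into D. If a Jordan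
algebra is finitely generated modulo D, then long products of multiplication operators map it into
the square of D, because such operators anticommute two steps apart on D. Multiplications by
elements of high degree are combinations of such products, so elements of high degree lie in the
square of D (`IsJordanProduct.exists_le_jordanSqSq`). This is carried out in the relatively free
algebra, where homogeneity of the variety allows all terms of the wrong degree to be dropped.

Splitting is used twice. It shows that the subalgebra B generated by the family is a finitely
generated module (`exists_wordSpan_univ_le`). It also rewrites long words through long words in
finitely many words of length at least 2 ^ r (`exists_derived_family`); for large r the latter lie
in Z B plus the kernel, and modulo Z B only the kernel parts matter. -/

namespace ShirshovRadical

/-! ### Spans of values of nonassociative words -/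

section Words

variable (Φ : Type u) [CommRing Φ]
variable {A : Type u} [NonUnitalNonAssocRing A] [Module Φ A]
variable {C : Type u} [NonUnitalNonAssocRing C] [Module Φ C]
variable {ι κ : Type*}

/-- The span of the values, under the substitution `v`, of the nonassociative words of `s`. -/
def wordSpan (v : ι → A) (s : Set (FreeMagma ι)) : Submodule Φ A :=
  Submodule.span Φ ((fun w => FreeMagma.lift v w) '' s)

variable {Φ}

theorem lift_mem_wordSpan {v : ι → A} {s : Set (FreeMagma ι)} {w : FreeMagma ι} (hw : w ∈ s) :
    FreeMagma.lift v w ∈ wordSpan Φ v s :=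
  Submodule.subset_span ⟨w, hw, rfl⟩

theorem wordSpan_le {v : ι → A} {s : Set (FreeMagma ι)} {N : Submodule Φ A}
    (h : ∀ w ∈ s, FreeMagma.lift v w ∈ N) : wordSpan Φ v s ≤ N :=
  Submodule.span_le.2 (by rintro _ ⟨w, hw, rfl⟩; exact h w hw)

theorem wordSpan_mono (v : ι → A) {s t : Set (FreeMagma ι)} (h : s ⊆ t) :
    wordSpan Φ v s ≤ wordSpan Φ v t :=
  Submodule.span_mono (Set.image_mono h)

theorem map_lift_word (φ : A →ₙₐ[Φ] C) (v : ι → A) (w : FreeMagma ι) :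
    φ (FreeMagma.lift v w) = FreeMagma.lift (fun i => φ (v i)) w := by
  induction w with
  | ih1 x => simp
  | ih2 x y hx hy => simp only [map_mul, hx, hy]

theorem map_wordSpan (φ : A →ₙₐ[Φ] C) (v : ι → A) (s : Set (FreeMagma ι)) :
    (wordSpan Φ v s).map (φ : A →ₗ[Φ] C) = wordSpan Φ (fun i => φ (v i)) s := by
  unfold wordSpan
  rw [Submodule.map_span, Set.image_image]
  congr 1
  exact Set.image_congr fun w _ => map_lift_word φ v w

theorem lift_map_word (f : κ → ι) (v : ι → A) (w : FreeMagma κ) :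
    FreeMagma.lift v (FreeMagma.map f w) = FreeMagma.lift (fun i => v (f i)) w := by
  induction w with
  | ih1 x => simp
  | ih2 x y hx hy => simp only [map_mul, hx, hy]

/-- A word of length at least `m` is a product of exactly `m` elements. -/
theorem exists_regroup (v : ι → A) (w : FreeMagma ι) :
    ∀ m, 1 ≤ m → m ≤ w.length →
      ∃ w' : FreeMagma A, w'.length = m ∧ FreeMagma.lift (id : A → A) w' = FreeMagma.lift v w := by
  induction w with
  | ih1 x =>
    intro m h1 h2
    have : m = 1 := le_antisymm h2 h1
    exact ⟨FreeMagma.of (v x), by simp [this, FreeMagma.length], by simp⟩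
  | ih2 x y hx hy =>
    intro m h1 h2
    have h2' : m ≤ x.length + y.length := h2
    have px := x.length_pos
    have py := y.length_pos
    rcases Nat.lt_or_ge m 2 with h | h
    · have : m = 1 := by omega
      exact ⟨FreeMagma.of (FreeMagma.lift v (x * y)), by simp [this, FreeMagma.length], by simp⟩
    -- The left factor takes as many of the `m` pieces as it can while leaving at least one for the
    -- right factor.
    · obtain ⟨a, ha, ha'⟩ := hx (min x.length (m - 1)) (by omega) (by omega)
      obtain ⟨b, hb, hb'⟩ := hy (m - min x.length (m - 1)) (by omega) (by omega)
      refine ⟨a * b, ?_, by rw [map_mul, map_mul, ha', hb']⟩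
      change a.length + b.length = m
      omega

theorem finite_length_le [Finite ι] (k : ℕ) : {u : FreeMagma ι | u.length ≤ k}.Finite := by
  induction k with
  | zero =>
    convert Set.finite_empty
    ext u
    have := u.length_pos
    simp; omega
  | succ k ih =>
    refine ((Set.finite_range (FreeMagma.of : ι → FreeMagma ι)).union
      (Set.Finite.image2 (· * ·) ih ih)).subset ?_
    intro u hu
    induction u with
    | ih1 x => exact Or.inl ⟨x, rfl⟩
    | ih2 x y _ _ =>
      have h : x.length + y.length ≤ k + 1 := hu
      have px := x.length_pos
      have py := y.length_pos
      exact Or.inr ⟨x, by simp; omega, y, by simp; omega, rfl⟩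

theorem wordSpan_fg [Finite ι] (v : ι → A) (k : ℕ) :
    (wordSpan Φ v {u | u.length ≤ k}).FG :=
  Submodule.fg_span ((finite_length_le k).image _)

theorem exists_fg_le_wordSpan (v : ι → A) {N : Submodule Φ A} (hN : N.FG)
    (h : N ≤ wordSpan Φ v Set.univ) : ∃ k, N ≤ wordSpan Φ v {u | u.length ≤ k} := by
  obtain ⟨S, rfl⟩ := hN
  have key : ∀ x ∈ wordSpan Φ v Set.univ, ∃ k, x ∈ wordSpan Φ v {u | u.length ≤ k} := by
    intro x hx
    induction hx using Submodule.span_induction with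
    | mem x hx =>
      obtain ⟨w, -, rfl⟩ := hx
      exact ⟨w.length, lift_mem_wordSpan (le_refl w.length)⟩
    | zero => exact ⟨0, zero_mem _⟩
    | add x y _ _ hx hy =>
      obtain ⟨a, ha⟩ := hx
      obtain ⟨b, hb⟩ := hy
      refine ⟨max a b, add_mem (wordSpan_mono v (fun u hu => ?_) ha)
        (wordSpan_mono v (fun u hu => ?_) hb)⟩
      · exact (show u.length ≤ a from hu).trans (le_max_left _ _)
      · exact (show u.length ≤ b from hu).trans (le_max_right _ _)
    | smul a x _ hx =>
      obtain ⟨k, hk⟩ := hx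
      exact ⟨k, Submodule.smul_mem _ _ hk⟩
  have key' : ∀ x, ∃ k, x ∈ S → x ∈ wordSpan Φ v {u | u.length ≤ k} := by
    intro x
    by_cases hx : x ∈ S
    · obtain ⟨k, hk⟩ := key x (h (Submodule.subset_span hx))
      exact ⟨k, fun _ => hk⟩
    · exact ⟨0, fun h => absurd h hx⟩
  choose k hk using key'
  refine ⟨S.sup k, Submodule.span_le.2 fun x hx => wordSpan_mono v (fun u hu => ?_) (hk x hx)⟩
  exact (show u.length ≤ k x from hu).trans (Finset.le_sup hx)

theorem wordSpan_le_power {v : ι → A} {m : ℕ} (hm : 1 ≤ m) :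
    wordSpan Φ v {w | m ≤ w.length} ≤ power Φ A m :=
  wordSpan_le fun w hw => by
    obtain ⟨w', h1, h2⟩ := exists_regroup v w m hm hw
    exact Submodule.subset_span ⟨w', h1, h2⟩

variable [IsScalarTower Φ A A] [SMulCommClass Φ A A]

theorem mul_mem_of_span {s t : Set A} {N : Submodule Φ A} (h : ∀ x ∈ s, ∀ y ∈ t, x * y ∈ N)
    {a b : A} (ha : a ∈ Submodule.span Φ s) (hb : b ∈ Submodule.span Φ t) : a * b ∈ N := by
  have : Submodule.map₂ (LinearMap.mul Φ A) (Submodule.span Φ s) (Submodule.span Φ t) ≤ N := by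
    rw [Submodule.map₂_span_span, Submodule.span_le]
    rintro _ ⟨x, hx, y, hy, rfl⟩
    exact h x hx y hy
  exact this (Submodule.apply_mem_map₂ (LinearMap.mul Φ A) ha hb)

theorem mul_mem_wordSpan {v : ι → A} {s t r : Set (FreeMagma ι)}
    (h : ∀ x ∈ s, ∀ y ∈ t, x * y ∈ r) {a b : A}
    (ha : a ∈ wordSpan Φ v s) (hb : b ∈ wordSpan Φ v t) : a * b ∈ wordSpan Φ v r := by
  refine mul_mem_of_span ?_ ha hb
  rintro _ ⟨x, hx, rfl⟩ _ ⟨y, hy, rfl⟩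
  simp only [← map_mul]
  exact lift_mem_wordSpan (h x hx y hy)

theorem lift_mem_wordSpan_of_forall {v : ι → A} {y : κ → A} {e : ℕ}
    (h : ∀ j, y j ∈ wordSpan Φ v {w | e ≤ w.length}) (w : FreeMagma κ) :
    FreeMagma.lift y w ∈ wordSpan Φ v {u | e * w.length ≤ u.length} := by
  induction w with
  | ih1 x => simpa [FreeMagma.length] using h x
  | ih2 a b ha hb =>
    rw [map_mul]
    refine mul_mem_wordSpan ?_ ha hb
    intro x hx z hz
    change e * (a.length + b.length) ≤ x.length + z.length
    rw [mul_add]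
    exact add_le_add hx hz

theorem adjoin_range_toSubmodule (v : ι → A) :
    (NonUnitalAlgebra.adjoin Φ (Set.range v)).toSubmodule = wordSpan Φ v Set.univ := by
  apply le_antisymm
  · let B : NonUnitalSubalgebra Φ A :=
      { wordSpan Φ v Set.univ with
        mul_mem' := fun ha hb => mul_mem_wordSpan (fun _ _ _ _ => Set.mem_univ _) ha hb }
    have : NonUnitalAlgebra.adjoin Φ (Set.range v) ≤ B := by
      apply NonUnitalAlgebra.adjoin_le
      rintro _ ⟨i, rfl⟩
      change v i ∈ wordSpan Φ v Set.univ
      simpa using lift_mem_wordSpan (Φ := Φ) (v := v) (Set.mem_univ (FreeMagma.of i))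
    exact this
  · refine wordSpan_le fun w hw => ?_
    clear hw
    change FreeMagma.lift v w ∈ NonUnitalAlgebra.adjoin Φ (Set.range v)
    induction w with
    | ih1 x => simpa using NonUnitalAlgebra.subset_adjoin Φ (Set.mem_range_self x)
    | ih2 x y hx hy => rw [map_mul]; exact mul_mem hx hy

theorem wordSpan_univ_eq_top {v : ι → A}
    (h : NonUnitalAlgebra.adjoin Φ (Set.range v) = ⊤) : wordSpan Φ v Set.univ = ⊤ := by
  rw [← adjoin_range_toSubmodule, h]; rfl

theorem power_le_wordSpan {v : ι → A} (h : wordSpan Φ v Set.univ = ⊤) (m : ℕ) :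
    power Φ A m ≤ wordSpan Φ v {w | m ≤ w.length} := by
  refine Submodule.span_le.2 ?_
  rintro _ ⟨w, rfl, rfl⟩
  have := lift_mem_wordSpan_of_forall (Φ := Φ) (v := v) (y := (id : A → A)) (e := 1)
    (fun j => wordSpan_mono v (fun u _ => u.length_pos) (by rw [h]; trivial)) w
  simpa using this

end Words

/-! ### Finiteness over an ideal in terms of generators -/

section Finiteness

variable (Φ : Type u) [CommRing Φ] (Z : Ideal Φ)
variable {A : Type u} [NonUnitalNonAssocRing A] [Module Φ A]
variable {C : Type u} [NonUnitalNonAssocRing C] [Module Φ C]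
variable {n : ℕ}

/-- The subalgebra generated by the family `v` is finite over `Z`, in terms of words: long words
are combinations, with coefficients in `Z`, of words of bounded length. -/
def IsFiniteFamily (v : Fin n → A) : Prop :=
  ∃ m k : ℕ, ∀ w : FreeMagma (Fin n), m ≤ w.length →
    FreeMagma.lift v w ∈ Z • wordSpan Φ v {u | u.length ≤ k}

variable (A) in
/-- Every finite family of elements of `A` generates a subalgebra that is finite over `Z`. -/
def IsLocallyFinite : Prop :=
  ∀ (n : ℕ) (v : Fin n → A), IsFiniteFamily Φ Z v

variable {Φ Z}

theorem IsFiniteFamily.map {v : Fin n → A} (h : IsFiniteFamily Φ Z v) (φ : A →ₙₐ[Φ] C) :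
    IsFiniteFamily Φ Z (fun i => φ (v i)) := by
  obtain ⟨m, k, h⟩ := h
  refine ⟨m, k, fun w hw => ?_⟩
  rw [← map_lift_word, ← map_wordSpan, ← Submodule.map_smul'']
  exact Submodule.mem_map_of_mem (h w hw)

theorem IsFiniteFamily.of_map {v : Fin n → A} (φ : A →ₙₐ[Φ] C) (hφ : Function.Injective φ)
    (h : IsFiniteFamily Φ Z (fun i => φ (v i))) : IsFiniteFamily Φ Z v := by
  obtain ⟨m, k, h⟩ := h
  refine ⟨m, k, fun w hw => ?_⟩
  have := h w hw
  rw [← map_lift_word, ← map_wordSpan, ← Submodule.map_smul''] at this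
  obtain ⟨x, hx, hxe⟩ := this
  rwa [← hφ hxe]

/-- With `Z = ⊤` the coefficients are unrestricted, and the condition only bounds the length of the
words needed to span. -/
theorem isModuleFinite_iff {v : Fin n → A} (hv : wordSpan Φ v Set.univ = ⊤) :
    Module.Finite Φ A ↔ IsFiniteFamily Φ ⊤ v := by
  constructor
  · intro h
    obtain ⟨k, hk⟩ := exists_fg_le_wordSpan v (Module.finite_def.1 h) (by rw [hv])
    refine ⟨0, k, fun w _ => ?_⟩
    simpa using hk Submodule.mem_top
  · rintro ⟨m, k, h⟩
    have hle : wordSpan Φ v Set.univ ≤ wordSpan Φ v {u | u.length ≤ max m k} := by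
      refine wordSpan_le fun w _ => ?_
      rcases le_total m w.length with hw | hw
      · have := h w hw
        rw [Submodule.top_smul] at this
        refine wordSpan_mono v (fun u hu => ?_) this
        exact (show u.length ≤ k from hu).trans (le_max_right _ _)
      · exact lift_mem_wordSpan (show w.length ≤ max m k from hw.trans (le_max_left _ _))
    have hfg := wordSpan_fg (Φ := Φ) v (max m k)
    rw [hv, top_le_iff] at hle
    rw [hle] at hfg
    exact ⟨hfg⟩

variable [IsScalarTower Φ A A] [SMulCommClass Φ A A]

/-- Finitely many elements involve only words of bounded length, and there are finitely many such
words; long words span the powers of the algebra. -/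
theorem isFiniteOver_iff {v : Fin n → A} (hv : wordSpan Φ v Set.univ = ⊤) (hA : IsFinGen Φ A) :
    IsFiniteOver Φ A Z ↔ IsFiniteFamily Φ Z v := by
  constructor
  · rintro ⟨-, m, hm, r, a, ha⟩
    obtain ⟨k, hk⟩ := exists_fg_le_wordSpan v
      (Submodule.fg_span (R := Φ) (Set.finite_range a)) (by rw [hv]; exact le_top)
    refine ⟨m, k, fun w hw => ?_⟩
    obtain ⟨z, hz, hx⟩ := ha _ (wordSpan_le_power (Φ := Φ) hm (lift_mem_wordSpan (v := v) hw))
    rw [hx]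
    exact Submodule.sum_mem _ fun i _ => Submodule.smul_mem_smul (hz i)
      (hk (Submodule.subset_span ⟨i, rfl⟩))
  · rintro ⟨m, k, h⟩
    obtain ⟨r, a, ha⟩ := Submodule.fg_iff_exists_fin_generating_family.1
      (wordSpan_fg (Φ := Φ) v k)
    -- The bound for families may be `m = 0`, while powers start at exponent 1.
    refine ⟨hA, m + 1, by omega, r, a, fun x hx => ?_⟩
    have h1 := power_le_wordSpan hv (m + 1) hx
    have h2 : wordSpan Φ v {w | m + 1 ≤ w.length} ≤ Z • wordSpan Φ v {u | u.length ≤ k} :=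
      wordSpan_le fun w hw => h w (le_trans (Nat.le_succ m) hw)
    have h3 := h2 h1
    rw [← ha, Submodule.mem_ideal_smul_span_iff_exists_sum] at h3
    obtain ⟨c, hc, hs⟩ := h3
    refine ⟨c, hc, ?_⟩
    rw [← hs, Finsupp.sum_fintype]
    simp

theorem isNilpotentAlg_iff {v : Fin n → A} (hv : wordSpan Φ v Set.univ = ⊤) :
    IsNilpotentAlg Φ A ↔ IsFiniteFamily Φ ⊥ v := by
  constructor
  · rintro ⟨m, hm, h⟩
    refine ⟨m, 0, fun w hw => ?_⟩
    have := wordSpan_le_power (Φ := Φ) hm (lift_mem_wordSpan (v := v) hw)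
    rw [h, Submodule.mem_bot] at this
    rw [this]
    exact zero_mem _
  · rintro ⟨m, k, h⟩
    refine ⟨m + 1, by omega, ?_⟩
    rw [eq_bot_iff]
    refine (power_le_wordSpan hv (m + 1)).trans (wordSpan_le fun w hw => ?_)
    simpa using h w (le_trans (Nat.le_succ m) hw)

/-- A property of the finitely generated subalgebras that is expressed by the finiteness over `Z`
of finite families of generators holds for all of them exactly in locally finite algebras. -/
theorem forall_finGen_iff {P : NonUnitalSubalgebra Φ A → Prop}
    (hP : ∀ (B : NonUnitalSubalgebra Φ A) (n : ℕ) (v : Fin n → B), IsFinGen Φ B →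
      wordSpan Φ v Set.univ = ⊤ → (P B ↔ IsFiniteFamily Φ Z v)) :
    (∀ B : NonUnitalSubalgebra Φ A, IsFinGen Φ B → P B) ↔ IsLocallyFinite Φ Z A := by
  constructor
  · intro h n v
    let B := NonUnitalAlgebra.adjoin Φ (Set.range v)
    let v' : Fin n → B := fun i => ⟨v i, NonUnitalAlgebra.subset_adjoin Φ ⟨i, rfl⟩⟩
    have hB : wordSpan Φ v' Set.univ = ⊤ := by
      have hi : Function.Injective
          (NonUnitalSubalgebraClass.subtype B : B →ₗ[Φ] A) := Subtype.val_injective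
      apply Submodule.map_injective_of_injective hi
      rw [map_wordSpan, Submodule.map_top]
      change wordSpan Φ v Set.univ = _
      rw [← adjoin_range_toSubmodule]
      ext x
      simp [B]
    have hB' : NonUnitalAlgebra.adjoin Φ (Set.range v') = ⊤ := by
      rw [← NonUnitalSubalgebra.toSubmodule_inj, adjoin_range_toSubmodule, hB]
      rfl
    have hg : IsFinGen Φ B := ⟨Set.range v', Set.finite_range v', hB'⟩
    exact (((hP B n v' hg hB).1 (h B hg)).map (NonUnitalSubalgebraClass.subtype B) :)
  · rintro h B ⟨S, hS, hB⟩
    obtain ⟨n, v, hv⟩ := hS.fin_embedding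
    have hv' : NonUnitalAlgebra.adjoin Φ (Set.range v) = ⊤ := by rw [hv, hB]
    refine (hP B n v ⟨S, hS, hB⟩ (wordSpan_univ_eq_top hv')).2 ?_
    exact IsFiniteFamily.of_map (NonUnitalSubalgebraClass.subtype B) Subtype.val_injective
      (h n fun i => (v i : A))

variable (Φ Z A) in
theorem isLocallyFiniteOver_iff : IsLocallyFiniteOver Φ A Z ↔ IsLocallyFinite Φ Z A :=
  forall_finGen_iff fun _ _ _ hB hv => isFiniteOver_iff hv hB

variable (Φ A) in
theorem isLocallyNilpotentAlg_iff : IsLocallyNilpotentAlg Φ A ↔ IsLocallyFinite Φ ⊥ A :=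
  forall_finGen_iff fun _ _ _ _ hv => isNilpotentAlg_iff hv

variable (Φ A) in
theorem isLocallyFiniteAlg_iff : IsLocallyFiniteAlg Φ A ↔ IsLocallyFinite Φ ⊤ A :=
  forall_finGen_iff fun _ _ _ _ hv => isModuleFinite_iff hv

end Finiteness

/-! ### Jordan algebras finitely generated modulo their square -/

section Jordan

variable {Φ : Type u} [CommRing Φ] {V : Type u} [AddCommGroup V] [Module Φ V]

/-- A commutative bilinear product satisfying the linearized Jordan identity. -/
structure IsJordanProduct (m : V →ₗ[Φ] V →ₗ[Φ] V) : Prop where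
  comm : ∀ x y, m x y = m y x
  jordan : ∀ x p q r, m (m (m x p) q) r + m (m (m x r) q) p =
    m (m x p) (m q r) + m (m x r) (m p q) + m (m x q) (m p r) - m x (m (m p r) q)

variable (m : V →ₗ[Φ] V →ₗ[Φ] V)

/-- The square of the algebra with product `m`. -/
def jordanSq : Submodule Φ V := Submodule.map₂ m ⊤ ⊤

/-- The square of the square of the algebra with product `m`. -/
def jordanSqSq : Submodule Φ V := Submodule.map₂ m (jordanSq m) (jordanSq m)

/-- The elements `y` such that `(⋯((((y q₁) p₁) q₂) p₂) ⋯ qⱼ) pⱼ` lies in the square of the square,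
for all `qᵢ` and all `pᵢ` of `N`. -/
def annihilated (N : Submodule Φ V) : ℕ → Submodule Φ V
  | 0 => jordanSqSq m
  | j + 1 => ⨅ q : V, ⨅ p : N, (annihilated N j).comap (m p ∘ₗ m q)

variable {m}

theorem mul_mem_jordanSq (x y : V) : m x y ∈ jordanSq m :=
  Submodule.apply_mem_map₂ m Submodule.mem_top Submodule.mem_top

theorem mul_mem_jordanSqSq {x y : V} (hx : x ∈ jordanSq m) (hy : y ∈ jordanSq m) :
    m x y ∈ jordanSqSq m :=
  Submodule.apply_mem_map₂ m hx hy

namespace IsJordanProduct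

variable (hm : IsJordanProduct m)
include hm

theorem mem_annihilated_succ {N : Submodule Φ V} {j : ℕ} {y : V} :
    y ∈ annihilated m N (j + 1) ↔ ∀ q, ∀ p ∈ N, m (m y q) p ∈ annihilated m N j := by
  simp only [annihilated, Submodule.mem_iInf, Submodule.mem_comap, LinearMap.comp_apply,
    Subtype.forall]
  refine forall_congr' fun q => forall₂_congr fun p _ => ?_
  rw [hm.comm p, hm.comm q]

/-- Right multiplications by elements of equal parity anticommute modulo the square of the
square. -/
theorem swap_mem {y : V} (hy : y ∈ jordanSq m) (p q r : V) :
    m (m (m y p) q) r + m (m (m y r) q) p ∈ jordanSqSq m := by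
  rw [hm.jordan]
  have h := fun a b => mul_mem_jordanSq (m := m) a b
  exact sub_mem (add_mem (add_mem (mul_mem_jordanSqSq (h _ _) (h _ _))
    (mul_mem_jordanSqSq (h _ _) (h _ _))) (mul_mem_jordanSqSq (h _ _) (h _ _)))
    (mul_mem_jordanSqSq hy (h _ _))

/-- For x = y t with both factors in the square, exchanging `t` and `p` in ((y t) q) p leaves a
product of ((y p) q) and `t`, two elements of the square. Only pairs of multiplications are claimed
to preserve `jordanSqSq m`. -/
theorem jordanSqSq_mul_mul_mem {x : V} (hx : x ∈ jordanSqSq m) (q p : V) :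
    m (m x q) p ∈ jordanSqSq m := by
  have : jordanSqSq m ≤ (jordanSqSq m).comap (m p ∘ₗ m q) := by
    refine Submodule.map₂_le.2 fun y hy t ht => ?_
    change m p (m q (m y t)) ∈ jordanSqSq m
    rw [hm.comm p, hm.comm q]
    refine (Submodule.add_mem_iff_left _ ?_).1 (hm.swap_mem hy t q p)
    exact mul_mem_jordanSqSq (mul_mem_jordanSq _ _) ht
  have h := this hx
  change m p (m q x) ∈ jordanSqSq m at h
  rwa [hm.comm p, hm.comm q] at h

theorem jordanSqSq_le_annihilated (N : Submodule Φ V) (j : ℕ) :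
    jordanSqSq m ≤ annihilated m N j := by
  induction j with
  | zero => exact le_rfl
  | succ j ih =>
    intro x hx
    rw [hm.mem_annihilated_succ]
    exact fun q p _ => ih (hm.jordanSqSq_mul_mul_mem hx q p)

/-- The elements `p` and `r` can be exchanged in a product that lies in `annihilated m N j`. -/
theorem swap_mem_annihilated {N : Submodule Φ V} {j : ℕ} {y : V} (hy : y ∈ jordanSq m)
    {p q r : V} (h : m (m (m y p) q) r ∈ annihilated m N j) :
    m (m (m y r) q) p ∈ annihilated m N j :=
  (Submodule.add_mem_iff_right _ h).1 (hm.jordanSqSq_le_annihilated N j (hm.swap_mem hy p q r))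

/-- Once `b` has occurred, a further occurrence in a position of the same parity costs nothing:
exchanging `b` with itself shows that twice the product lies in `jordanSqSq m`, and 2 is invertible.
Factors from `N` are first moved past `b`. -/
theorem mem_annihilated_sup_of_mul (htwo : IsUnit (2 : Φ)) {N : Submodule Φ V} {b : V} :
    ∀ (j : ℕ) {y : V} (q : V), y ∈ jordanSq m → m (m y q) b ∈ annihilated m N j →
      m (m y q) b ∈ annihilated m (N ⊔ Submodule.span Φ {b}) j := by
  intro j
  induction j with
  | zero => exact fun _ _ h => h
  | succ j ih =>
    intro y q hy h
    rw [hm.mem_annihilated_succ] at h ⊢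
    intro q' p hp
    obtain ⟨x, hx, c, hc, rfl⟩ := Submodule.mem_sup.1 hp
    obtain ⟨c, rfl⟩ := Submodule.mem_span_singleton.1 hc
    rw [map_add, map_smul]
    refine add_mem ?_ (Submodule.smul_mem _ _ ?_)
    · have hy' : m (m y q) x ∈ jordanSq m := mul_mem_jordanSq _ _
      exact hm.swap_mem_annihilated (mul_mem_jordanSq _ _)
        (ih q' hy' (hm.swap_mem_annihilated (mul_mem_jordanSq _ _) (h q' x hx)))
    · have h2 := hm.swap_mem (mul_mem_jordanSq (m := m) y q) b q' b
      rw [← two_smul Φ] at h2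
      obtain ⟨e, he⟩ := htwo
      rw [← he] at h2
      have h3 := Submodule.smul_mem _ (↑e⁻¹ : Φ) h2
      rw [smul_smul, Units.inv_mul, one_smul] at h3
      exact hm.jordanSqSq_le_annihilated _ j h3

/-- Expand each factor along `N` and `b`. Either all factors are in `N`, or some factor is `b` and
can be moved to the front, where the last hypothesis applies. -/
theorem mem_annihilated_sup {N : Submodule Φ V} {b : V} :
    ∀ (j : ℕ) {y : V}, y ∈ jordanSq m → y ∈ annihilated m N (j + 1) →
      (∀ q, m (m y q) b ∈ annihilated m (N ⊔ Submodule.span Φ {b}) j) →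
      y ∈ annihilated m (N ⊔ Submodule.span Φ {b}) (j + 1) := by
  intro j
  induction j with
  | zero =>
    intro y hy h hb
    rw [hm.mem_annihilated_succ] at h ⊢
    intro q p hp
    obtain ⟨x, hx, c, hc, rfl⟩ := Submodule.mem_sup.1 hp
    obtain ⟨c, rfl⟩ := Submodule.mem_span_singleton.1 hc
    rw [map_add, map_smul]
    exact add_mem (h q x hx) (Submodule.smul_mem _ _ (hb q))
  | succ j ih =>
    intro y hy h hb
    rw [hm.mem_annihilated_succ] at h ⊢
    intro q p hp
    obtain ⟨x, hx, c, hc, rfl⟩ := Submodule.mem_sup.1 hp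
    obtain ⟨c, rfl⟩ := Submodule.mem_span_singleton.1 hc
    rw [map_add, map_smul]
    refine add_mem ?_ (Submodule.smul_mem _ _ (hb q))
    refine ih (mul_mem_jordanSq _ _) (h q x hx) fun q' => ?_
    refine hm.swap_mem_annihilated (mul_mem_jordanSq _ _) ?_
    exact hm.mem_annihilated_succ.1 (hb q) q' x (Submodule.mem_sup_left hx)

/-- If the algebra is spanned by its square and `n` elements, then long products starting in the
square lie in the square of the square. -/
theorem exists_jordanSq_le_annihilated (htwo : IsUnit (2 : Φ)) (S : Finset V) :
    ∃ j, jordanSq m ≤ annihilated m (jordanSq m ⊔ Submodule.span Φ (S : Set V)) (j + 1) := by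
  classical
  induction S using Finset.induction_on with
  | empty =>
    refine ⟨0, fun y hy => ?_⟩
    rw [hm.mem_annihilated_succ]
    intro q p hp
    simp only [Finset.coe_empty, Submodule.span_empty, sup_bot_eq] at hp
    exact mul_mem_jordanSqSq (mul_mem_jordanSq _ _) hp
  | insert b S _ ih =>
    obtain ⟨j, hj⟩ := ih
    have e : jordanSq m ⊔ Submodule.span Φ (insert b S : Finset V) =
        (jordanSq m ⊔ Submodule.span Φ (S : Set V)) ⊔ Submodule.span Φ {b} := by
      rw [Finset.coe_insert, Submodule.span_insert, sup_comm (Submodule.span Φ {b}), sup_assoc]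
    -- Each new generator costs one more pair of multiplications: the pair that may contain its
    -- first occurrence.
    refine ⟨j + 1, fun y hy => ?_⟩
    rw [e]
    refine hm.mem_annihilated_sup (j + 1) hy ?_ fun q => ?_
    · rw [hm.mem_annihilated_succ]
      exact fun q p _ => hj (mul_mem_jordanSq _ _)
    · exact hm.mem_annihilated_sup_of_mul htwo (j + 1) q hy (hj (mul_mem_jordanSq _ _))

end IsJordanProduct

/-! ### Multiplications by elements of high degree -/

section Multiplications

variable (m)

/-- The operators that are combinations of products of at least `k` multiplications. -/
def multPower (k : ℕ) : Submodule Φ (Module.End Φ V) :=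
  ⨆ j : {j : ℕ // k ≤ j}, (LinearMap.range m : Submodule Φ (Module.End Φ V)) ^ (j : ℕ)

variable {m}

theorem multPower_anti {k l : ℕ} (h : k ≤ l) : multPower m l ≤ multPower m k :=
  iSup_le fun j => le_iSup (fun j : {j : ℕ // k ≤ j} =>
    (LinearMap.range m : Submodule Φ (Module.End Φ V)) ^ (j : ℕ)) ⟨j.1, h.trans j.2⟩

theorem mul_mem_multPower {k l : ℕ} {f g : Module.End Φ V} (hf : f ∈ multPower m k)
    (hg : g ∈ multPower m l) : f * g ∈ multPower m (k + l) := by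
  have h : multPower m k * multPower m l ≤ multPower m (k + l) := by
    unfold multPower
    rw [Submodule.iSup_mul]
    refine iSup_le fun i => ?_
    rw [Submodule.mul_iSup]
    refine iSup_le fun j => ?_
    rw [← pow_add]
    exact le_iSup (fun j : {j : ℕ // k + l ≤ j} =>
      (LinearMap.range m : Submodule Φ (Module.End Φ V)) ^ (j : ℕ))
      ⟨i.1 + j.1, add_le_add i.2 j.2⟩
  exact h (Submodule.mul_mem_mul hf hg)

theorem mem_multPower_one (x : V) : m x ∈ multPower m 1 := by
  have : m x ∈ (LinearMap.range m : Submodule Φ (Module.End Φ V)) ^ 1 := by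
    rw [pow_one]; exact ⟨x, rfl⟩
  exact Submodule.mem_iSup_of_mem ⟨1, le_rfl⟩ this

namespace IsJordanProduct

variable (hm : IsJordanProduct m)
include hm

/-- The linearized Jordan identity, read as an identity of operators in `x`: multiplication by a
triple product is a combination of products of two or three multiplications by shorter elements. -/
theorem mult_mul_mul (p q r : V) : m (m (m p r) q) =
    m (m q r) * m p + m (m p q) * m r + m (m p r) * m q
      - m r * (m q * m p) - m p * (m q * m r) := by
  ext x
  have := hm.jordan x p q r
  have c := hm.comm
  simp only [LinearMap.sub_apply, LinearMap.add_apply, Module.End.mul_apply]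
  rw [c _ x, c p x, c r x, c q x, c _ (m x p), c _ (m x r), c _ (m x q), c r (m _ _),
    c p (m _ _), c q (m x p), c q (m x r), sub_sub, this, sub_sub_cancel]

/-- Multiplications by elements of high degree are combinations of products of many
multiplications. -/
theorem mult_mem_multPower {G : ℕ → Submodule Φ V}
    (hG : ∀ i j, ∀ x ∈ G i, ∀ y ∈ G j, m x y ∈ G (i + j)) {c : ℕ}
    (hgen : ∀ d, c ≤ d → G d ≤ ⨆ p : {p : ℕ × ℕ // 0 < p.1 ∧ 0 < p.2 ∧ p.1 + p.2 = d},
      Submodule.map₂ m (G p.1.1) (G p.1.2)) {C : ℕ} (hC : 0 < C) (hcC : 2 * c ≤ C) :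
    ∀ d k, C * k < d + C → ∀ x ∈ G d, m x ∈ multPower m k := by
  intro d
  induction d using Nat.strong_induction_on with
  | _ d ih =>
  intro k hk x hx
  rcases Nat.lt_or_ge k 2 with h2 | h2
  · exact multPower_anti (by omega : k ≤ 1) (mem_multPower_one x)
  have hd : C < d := by
    have := Nat.mul_le_mul_left C h2
    omega
  -- The ceiling of t / C. The assumption on `k` says that k is at most the ceiling of d / C, and
  -- ceilings are subadditive, so no multiplications are lost when the degree is distributed over
  -- the factors.
  let e : ℕ → ℕ := fun t => (t + C - 1) / C
  have he1 : ∀ t, C * e t < t + C := fun t => by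
    have := Nat.mul_div_le (t + C - 1) C
    change C * ((t + C - 1) / C) < t + C
    omega
  have he2 : ∀ t, t ≤ C * e t := fun t => by
    have := Nat.lt_mul_div_succ (t + C - 1) hC
    change t ≤ C * ((t + C - 1) / C)
    rw [mul_add] at this
    omega
  have step : ∀ a b f, 0 < a → 0 < b → 0 < f → a + b + f = d → ∀ p ∈ G a, ∀ r ∈ G b, ∀ q ∈ G f,
      m (m (m p r) q) ∈ multPower m k := by
    intro a b f ha hb hf habf p hp r hr q hq
    have mem : ∀ t, t < d → ∀ z ∈ G t, m z ∈ multPower m (e t) :=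
      fun t ht z hz => ih t ht (e t) (he1 t) z hz
    have two : ∀ s t, s < d → t < d → s + t = d → ∀ y ∈ G s, ∀ z ∈ G t,
        m y * m z ∈ multPower m k := by
      intro s t hs ht hst y hy z hz
      refine multPower_anti ?_ (mul_mem_multPower (mem s hs y hy) (mem t ht z hz))
      by_contra hlt
      have := Nat.mul_le_mul_left C (by omega : e s + e t + 1 ≤ k)
      rw [mul_add, mul_add] at this
      have := he2 s
      have := he2 t
      omega
    have three : ∀ s t u, s < d → t < d → u < d → s + t + u = d → ∀ y ∈ G s, ∀ z ∈ G t,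
        ∀ w ∈ G u, m y * (m z * m w) ∈ multPower m k := by
      intro s t u hs ht hu hst y hy z hz w hw
      refine multPower_anti ?_ (mul_mem_multPower (mem s hs y hy)
        (mul_mem_multPower (mem t ht z hz) (mem u hu w hw)))
      by_contra hlt
      have := Nat.mul_le_mul_left C (by omega : e s + (e t + e u) + 1 ≤ k)
      rw [mul_add, mul_add, mul_add] at this
      have := he2 s
      have := he2 t
      have := he2 u
      omega
    rw [hm.mult_mul_mul]
    refine sub_mem (sub_mem (add_mem (add_mem ?_ ?_) ?_) ?_) ?_
    · exact two (f + b) a (by omega) (by omega) (by omega) _ (hG _ _ _ hq _ hr) _ hp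
    · exact two (a + f) b (by omega) (by omega) (by omega) _ (hG _ _ _ hp _ hq) _ hr
    · exact two (a + b) f (by omega) (by omega) (by omega) _ (hG _ _ _ hp _ hr) _ hq
    · exact three b f a (by omega) (by omega) (by omega) (by omega) _ hr _ hq _ hp
    · exact three a f b (by omega) (by omega) (by omega) (by omega) _ hp _ hq _ hr
  have step' : ∀ i j, c ≤ i → 0 < j → i + j = d → ∀ y ∈ G i, ∀ z ∈ G j,
      m (m y z) ∈ multPower m k := by
    intro i j hi hj hij y hy z hz
    have : G i ≤ (multPower m k).comap (m ∘ₗ m.flip z) := by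
      refine (hgen i hi).trans (iSup_le ?_)
      rintro ⟨⟨a, b⟩, ha, hb, hab⟩
      refine Submodule.map₂_le.2 fun p hp r hr => ?_
      exact step a b j ha hb hj (by simp at hab; omega) p hp r hr z hz
    exact this hy
  -- Since d > C ≥ 2 c, one of the two factors has degree at least `c` and splits again, giving a
  -- triple product.
  have : G d ≤ (multPower m k).comap m := by
    refine (hgen d (by omega)).trans (iSup_le ?_)
    rintro ⟨⟨i, j⟩, hi, hj, hij⟩
    refine Submodule.map₂_le.2 fun y hy z hz => ?_
    simp only at hi hj hij hy hz
    rw [Submodule.mem_comap]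
    rcases le_total c i with h | h
    · exact step' i j h hj hij y hy z hz
    · rw [hm.comm]
      exact step' j i (by omega) hi (by omega) z hz y hy
  exact this hx

theorem apply_mem_of_mem_pow (j : ℕ) : ∀ y ∈ annihilated m ⊤ j,
    ∀ f ∈ (LinearMap.range m : Submodule Φ (Module.End Φ V)) ^ (2 * j), f y ∈ jordanSqSq m := by
  induction j with
  | zero =>
    intro y hy f hf
    rw [mul_zero, pow_zero, Submodule.mem_one] at hf
    obtain ⟨a, rfl⟩ := hf
    rw [Module.algebraMap_end_apply]
    exact Submodule.smul_mem _ _ hy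
  | succ j ih =>
    intro y hy f hf
    rw [mul_add, mul_one, pow_add, pow_two] at hf
    have : ∀ f ∈ (LinearMap.range m : Submodule Φ (Module.End Φ V)) ^ (2 * j) *
        (LinearMap.range m * LinearMap.range m : Submodule Φ (Module.End Φ V)),
        f y ∈ jordanSqSq m := by
      intro f hf
      refine Submodule.mul_induction_on hf ?_ fun x y hx hy => add_mem hx hy
      intro g hg h hh
      refine Submodule.mul_induction_on hh ?_ ?_
      · rintro _ ⟨p, rfl⟩ _ ⟨q, rfl⟩
        change g (m p (m q y)) ∈ _
        rw [hm.comm p, hm.comm q]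
        exact ih _ (hm.mem_annihilated_succ.1 hy q p trivial) g hg
      · intro a b ha hb
        rw [mul_add]
        exact add_mem ha hb
    exact this f hf

/-- Surplus multiplications act first, the next one lands in the square, and the remaining 2 j carry
the square into its square. -/
theorem apply_mem_of_mem_multPower {j : ℕ} (hj : jordanSq m ≤ annihilated m ⊤ j)
    {f : Module.End Φ V} (hf : f ∈ multPower m (2 * j + 1)) (y : V) : f y ∈ jordanSqSq m := by
  have : multPower m (2 * j + 1) ≤ (jordanSqSq m).comap (LinearMap.applyₗ y) := by
    refine iSup_le ?_
    rintro ⟨i, hi⟩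
    obtain ⟨t, rfl⟩ := Nat.exists_eq_add_of_le hi
    simp only
    rw [add_assoc, pow_add, pow_add, pow_one, Submodule.mul_le]
    intro g hg h hh
    change g (h y) ∈ jordanSqSq m
    refine hm.apply_mem_of_mem_pow j _ (hj ?_) g hg
    refine Submodule.mul_induction_on hh ?_ fun a b ha hb => add_mem ha hb
    rintro _ ⟨p, rfl⟩ h' -
    exact mul_mem_jordanSq p (h' y)
  exact this hf

/-- In a Jordan algebra which is finitely generated modulo its square, elements of high degree
lie in the square of the square. -/
theorem exists_le_jordanSqSq (htwo : IsUnit (2 : Φ)) {G : ℕ → Submodule Φ V}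
    (hG : ∀ i j, ∀ x ∈ G i, ∀ y ∈ G j, m x y ∈ G (i + j)) {c : ℕ}
    (hgen : ∀ d, c ≤ d → G d ≤ ⨆ p : {p : ℕ × ℕ // 0 < p.1 ∧ 0 < p.2 ∧ p.1 + p.2 = d},
      Submodule.map₂ m (G p.1.1) (G p.1.2))
    {N : Submodule Φ V} (hN : N.FG) (htop : jordanSq m ⊔ N = ⊤) :
    ∃ e, ∀ d, e ≤ d → G d ≤ jordanSqSq m := by
  obtain ⟨S, rfl⟩ := hN
  obtain ⟨j, hj⟩ := hm.exists_jordanSq_le_annihilated htwo S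
  rw [htop] at hj
  let C := 2 * c + 1
  let k := 2 * (j + 1) + 1
  -- In a product of degree at least 2 C k, one factor has degree at least C k, so its
  -- multiplication lies in `multPower m k`; the summand `c` makes `hgen` applicable.
  refine ⟨2 * (C * k) + c, fun d hd => (hgen d (by omega)).trans (iSup_le ?_)⟩
  rintro ⟨⟨i, l⟩, hi, hl, hil⟩
  refine Submodule.map₂_le.2 fun y hy z hz => ?_
  simp only at hi hl hil hy hz
  have key : ∀ t, C * k ≤ t → ∀ x ∈ G t, ∀ w, m x w ∈ jordanSqSq m := fun t ht x hx w =>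
    hm.apply_mem_of_mem_multPower hj
      (hm.mult_mem_multPower hG hgen (C := C) (by omega) (by omega) t k (by omega) x hx) w
  rcases le_total (C * k) i with h | h
  · exact key i h y hy z
  · rw [hm.comm]
    exact key l (by omega) z hz y

end IsJordanProduct

end Multiplications

end Jordan

/-! ### The Jordan product of a noncommutative Jordan algebra -/

section NoncommutativeJordan

/-- Full linearization of P x x x gives the sum over all six permutations; symmetry in the first two
arguments pairs them into twice the cyclic sum. -/
theorem polarize {V : Type u} [AddCommGroup V] (htwo : ∀ x : V, x + x = 0 → x = 0)
    {P : V → V → V → V} (h1 : ∀ a b c d, P (a + b) c d = P a c d + P b c d)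
    (h2 : ∀ a b c d, P c (a + b) d = P c a d + P c b d)
    (h3 : ∀ a b c d, P c d (a + b) = P c d a + P c d b)
    (hs : ∀ a b c, P a b c = P b a c) (h0 : ∀ x, P x x x = 0) (a b c : V) :
    P a b c + P b c a + P c a b = 0 := by
  apply htwo
  have e := h0 (a + b + c)
  have e1 := h0 (a + b)
  have e2 := h0 (a + c)
  have e3 := h0 (b + c)
  have ea := h0 a
  have eb := h0 b
  have ec := h0 c
  simp only [h1, h2, h3, ea, eb, ec, hs b a, hs c a, hs c b] at e e1 e2 e3 ⊢
  linear_combination (norm := abel) e - e1 - e2 - e3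

variable {Φ : Type u} [CommRing Φ] {A : Type u} [NonUnitalNonAssocRing A]

theorem IsNoncommJordan.flexible (h : IsNoncommJordan A) (x y z : A) :
    associator x y z + associator z y x = 0 := by
  have e := h.1 (x + z) y
  have e1 := h.1 x y
  have e2 := h.1 z y
  simp only [associator, add_mul, mul_add] at *
  linear_combination (norm := abel) e - e1 - e2

variable [Module Φ A] [IsScalarTower Φ A A] [SMulCommClass Φ A A]

theorem eq_zero_of_add_self (htwo : IsUnit (2 : Φ)) {V : Type u} [AddCommGroup V] [Module Φ V]
    {x : V} (h : x + x = 0) : x = 0 := by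
  rw [← two_smul Φ] at h
  exact (htwo.smul_eq_zero).1 h

variable (Φ A) in
/-- The Jordan product `x * y + y * x`. -/
def jordanMul : A →ₗ[Φ] A →ₗ[Φ] A := LinearMap.mul Φ A + (LinearMap.mul Φ A).flip

theorem jordanMul_apply (x y : A) : jordanMul Φ A x y = x * y + y * x := rfl

/-- By polarization it suffices to treat equal arguments, where the claim is that Jordan
multiplications by x and by x² commute. This holds because left and right multiplications by x
commute with those by x². -/
theorem IsNoncommJordan.isJordanProduct (htwo : IsUnit (2 : Φ)) (h : IsNoncommJordan A) :
    IsJordanProduct (jordanMul Φ A) where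
  comm x y := by rw [jordanMul_apply, jordanMul_apply, add_comm]
  jordan x p q r := by
    have hc : ∀ x y, jordanMul Φ A x y = jordanMul Φ A y x := fun x y => by
      rw [jordanMul_apply, jordanMul_apply, add_comm]
    have key := polarize (V := A) (fun x => eq_zero_of_add_self htwo)
      (P := fun a b c => jordanMul Φ A (jordanMul Φ A (jordanMul Φ A a b) q) c
        - jordanMul Φ A (jordanMul Φ A a b) (jordanMul Φ A q c))
      (fun a b c d => by simp only [map_add, LinearMap.add_apply]; abel)
      (fun a b c d => by simp only [map_add, LinearMap.add_apply]; abel)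
      (fun a b c d => by simp only [map_add]; abel)
      (fun a b c => by rw [hc a b])
      (fun x => by
        have fl : ∀ y, x * y * x = x * (y * x) := fun y => sub_eq_zero.1 (h.1 x y)
        have j1 : x * x * q * x = x * x * (q * x) := sub_eq_zero.1 (h.2 x q)
        have j2 : x * q * (x * x) = x * (q * (x * x)) := by
          have := h.flexible x q (x * x)
          rw [h.2, add_zero] at this
          exact sub_eq_zero.1 this
        -- Flexibility expresses left multiplication by x² through the right one and the squares of
        -- the multiplications by x; this yields the remaining commutations `l` and `r`.
        have sq : ∀ y, x * x * y = y * (x * x) + x * (x * y) - y * x * x := fun y => by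
          have := h.flexible x x y
          simp only [associator] at this
          linear_combination (norm := abel) this
        have sq' : ∀ y, y * (x * x) = x * x * y - x * (x * y) + y * x * x := fun y => by
          rw [sq y]; abel
        have l : x * (x * x * q) = x * x * (x * q) := by
          rw [sq q, sq (x * q), mul_sub, mul_add, j2, fl q, fl (q * x)]
        have r : q * (x * x) * x = q * x * (x * x) := by
          rw [sq' q, sq' (q * x), add_mul, sub_mul, j1, fl (x * q), fl q]
        simp only [jordanMul_apply, add_mul, mul_add]
        rw [j1, j2, l, r]
        abel)
      x p r
    rw [hc (jordanMul Φ A (jordanMul Φ A p r) q) x, hc r x, hc (jordanMul Φ A p r), hc q x,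
      hc q p] at key
    rw [hc (jordanMul Φ A p r) q, hc (jordanMul Φ A x q)]
    linear_combination (norm := abel) key

/-- In a flexible algebra the commutator with `z` is a derivation of the Jordan product, hence
preserves its square. The anticommutator with `z` is itself a Jordan product, and one-sided products
are half the sum or difference of the two. -/
theorem IsNoncommJordan.mul_mem_jordanSq (htwo : IsUnit (2 : Φ)) (h : IsNoncommJordan A)
    {x : A} (hx : x ∈ jordanSq (jordanMul Φ A)) (z : A) :
    x * z ∈ jordanSq (jordanMul Φ A) ∧ z * x ∈ jordanSq (jordanMul Φ A) := by
  have half : ∀ y : A, y + y ∈ jordanSq (jordanMul Φ A) → y ∈ jordanSq (jordanMul Φ A) := by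
    intro y hy
    rw [← two_smul Φ] at hy
    obtain ⟨e, he⟩ := htwo
    rw [← he] at hy
    have := Submodule.smul_mem _ (↑e⁻¹ : Φ) hy
    rwa [smul_smul, Units.inv_mul, one_smul] at this
  have hD := fun a b => ShirshovRadical.mul_mem_jordanSq (m := jordanMul Φ A) a b
  have comm : x * z - z * x ∈ jordanSq (jordanMul Φ A) := by
    have : jordanSq (jordanMul Φ A) ≤ (jordanSq (jordanMul Φ A)).comap
        ((LinearMap.mul Φ A).flip z - LinearMap.mul Φ A z) := by
      refine Submodule.map₂_le.2 fun p _ q _ => ?_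
      rw [Submodule.mem_comap]
      have e : ((LinearMap.mul Φ A).flip z - LinearMap.mul Φ A z) (jordanMul Φ A p q) =
          jordanMul Φ A (p * z - z * p) q + jordanMul Φ A p (q * z - z * q) := by
        have f1 := h.flexible p q z
        have f2 := h.flexible q p z
        have f3 := h.flexible p z q
        simp only [associator] at f1 f2 f3
        simp only [LinearMap.sub_apply, LinearMap.flip_apply, LinearMap.mul_apply',
          jordanMul_apply, add_mul, mul_add, sub_mul, mul_sub]
        linear_combination (norm := abel) f1 + f2 - f3
      rw [e]
      exact add_mem (hD _ _) (hD _ _)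
    exact this hx
  have sum : x * z + z * x ∈ jordanSq (jordanMul Φ A) := hD x z
  constructor
  · apply half
    convert add_mem sum comm using 1
    abel
  · apply half
    convert sub_mem sum comm using 1
    abel

end NoncommutativeJordan

/-! ### Ideals and projections -/

section Ideals

variable {Φ : Type u} [CommRing Φ]
variable {A : Type u} [NonUnitalNonAssocRing A] [Module Φ A]

/-- The ideal given by a submodule that absorbs products. -/
def AlgIdeal.ofSubmodule (N : Submodule Φ A) (hl : ∀ a x : A, x ∈ N → a * x ∈ N)
    (hr : ∀ x a : A, x ∈ N → x * a ∈ N) : AlgIdeal Φ A where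
  toNonUnitalSubalgebra := { N with mul_mem' := fun {a b} _ hb => hl a b hb }
  mul_mem_left := hl
  mul_mem_right := hr

/-- The canonical projection as a homomorphism of algebras. -/
def AlgIdeal.projHom (I : AlgIdeal Φ A) : A →ₙₐ[Φ] I.Quot :=
  { I.proj with
    map_zero' := map_zero I.proj
    map_mul' := I.proj_mul }

theorem AlgIdeal.projHom_apply (I : AlgIdeal Φ A) (x : A) : I.projHom x = I.proj x := rfl

theorem AlgIdeal.proj_eq_zero {I : AlgIdeal Φ A} {x : A} :
    I.proj x = 0 ↔ x ∈ I.toNonUnitalSubalgebra := by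
  rw [← map_zero I.proj, I.proj_eq_proj, sub_zero]

end Ideals

/-! ### Relatively free algebras of a homogeneous variety -/

section Varieties

variable {Φ : Type u} [CommRing Φ] {E : Set (FreeNonUnitalNonAssocAlgebra Φ ℕ)}
variable {A : Type u} [NonUnitalNonAssocRing A] [Module Φ A]
  [IsScalarTower Φ A A] [SMulCommClass Φ A A]
variable {C : Type u} [NonUnitalNonAssocRing C] [Module Φ C]
  [IsScalarTower Φ C C] [SMulCommClass Φ C C]

theorem comp_lift (φ : A →ₙₐ[Φ] C) (v : ℕ → A) (f : FreeNonUnitalNonAssocAlgebra Φ ℕ) :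
    φ (FreeNonUnitalNonAssocAlgebra.lift Φ v f) =
      FreeNonUnitalNonAssocAlgebra.lift Φ (fun i => φ (v i)) f := by
  have : φ.comp (FreeNonUnitalNonAssocAlgebra.lift Φ v) =
      FreeNonUnitalNonAssocAlgebra.lift Φ (fun i => φ (v i)) := by
    refine FreeNonUnitalNonAssocAlgebra.hom_ext Φ fun i => ?_
    rw [NonUnitalAlgHom.comp_apply, FreeNonUnitalNonAssocAlgebra.lift_of_apply,
      FreeNonUnitalNonAssocAlgebra.lift_of_apply]
  exact DFunLike.congr_fun this f

theorem InVariety.of_surjective (φ : A →ₙₐ[Φ] C) (hφ : Function.Surjective φ)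
    (hA : InVariety E A) : InVariety E C := by
  intro f hf v
  choose v' hv' using fun i => hφ (v i)
  have := comp_lift φ v' f
  simp only [hv'] at this
  rw [← this, hA f hf v', map_zero]

variable (Φ) in
/-- The monomial of the free algebra given by a word. -/
noncomputable def monomial (w : FreeMagma ℕ) : FreeNonUnitalNonAssocAlgebra Φ ℕ :=
  FreeMagma.lift (FreeNonUnitalNonAssocAlgebra.of Φ) w

theorem monomial_mul (w w' : FreeMagma ℕ) :
    monomial Φ (w * w') = monomial Φ w * monomial Φ w' := map_mul _ _ _

theorem monomial_eq_single (w : FreeMagma ℕ) : monomial Φ w = MonoidAlgebra.single w 1 := by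
  induction w with
  | ih1 x => rfl
  | ih2 x y hx hy => rw [monomial_mul, hx, hy, MonoidAlgebra.single_mul_single, one_mul]

theorem span_range_monomial :
    Submodule.span Φ (Set.range (monomial Φ)) = ⊤ := by
  rw [eq_top_iff]
  rintro f -
  induction f using MonoidAlgebra.induction_linear with
  | zero => exact zero_mem _
  | add f g hf hg => exact add_mem hf hg
  | single w c =>
    have : MonoidAlgebra.single w c = c • monomial Φ w := by
      rw [monomial_eq_single, MonoidAlgebra.smul_single, smul_eq_mul, mul_one]
    rw [this]
    exact Submodule.smul_mem _ _ (Submodule.subset_span ⟨w, rfl⟩)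

theorem lift_monomial (v : ℕ → A) (w : FreeMagma ℕ) :
    FreeNonUnitalNonAssocAlgebra.lift Φ v (monomial Φ w) = FreeMagma.lift v w := by
  rw [monomial, map_lift_word]
  simp

variable (Φ) in
/-- The homogeneous component of degree `d`, as a linear map. -/
noncomputable def homogComponentₗ (d : ℕ) :
    FreeNonUnitalNonAssocAlgebra Φ ℕ →ₗ[Φ] FreeNonUnitalNonAssocAlgebra Φ ℕ where
  toFun := homogComponent d
  map_add' f g := by
    simp only [homogComponent, MonoidAlgebra.coeff_add, Finsupp.filter_add,
      MonoidAlgebra.ofCoeff_add]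
  map_smul' c f := by
    simp only [homogComponent, MonoidAlgebra.coeff_smul, Finsupp.filter_smul,
      MonoidAlgebra.ofCoeff_smul, RingHom.id_apply]

theorem homogComponent_monomial (d : ℕ) (w : FreeMagma ℕ) :
    homogComponentₗ Φ d (monomial Φ w) = if w.length = d then monomial Φ w else 0 := by
  rw [monomial_eq_single]
  change homogComponent d _ = _
  unfold homogComponent
  split_ifs with h
  · rw [MonoidAlgebra.coeff_single, Finsupp.filter_single_of_pos (fun w : FreeMagma ℕ => w.length = d) h]; rfl
  · rw [MonoidAlgebra.coeff_single, Finsupp.filter_single_of_neg (fun w : FreeMagma ℕ => w.length = d) h]; rfl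

variable (E)

/-- The identities of the variety in the first `n` variables, the others being replaced by `0`. -/
noncomputable def identities (n : ℕ) : AlgIdeal Φ (FreeNonUnitalNonAssocAlgebra Φ ℕ) :=
  AlgIdeal.ofSubmodule
    { carrier := {f | ∀ (A : Type u) [NonUnitalNonAssocRing A] [Module Φ A]
        [IsScalarTower Φ A A] [SMulCommClass Φ A A], InVariety E A →
        ∀ v : ℕ → A, (∀ i, n ≤ i → v i = 0) → FreeNonUnitalNonAssocAlgebra.lift Φ v f = 0}
      add_mem' := fun {f g} hf hg A _ _ _ _ hA v hv => by
        rw [map_add, hf A hA v hv, hg A hA v hv, add_zero]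
      zero_mem' := fun A _ _ _ _ hA v hv => map_zero _
      smul_mem' := fun c f hf A _ _ _ _ hA v hv => by
        rw [map_smul, hf A hA v hv, smul_zero] }
    (fun f g hg A _ _ _ _ hA v hv => by rw [map_mul, hg A hA v hv, mul_zero])
    (fun f g hf A _ _ _ _ hA v hv => by rw [map_mul, hf A hA v hv, zero_mul])

variable {E}

theorem mem_identities {n : ℕ} {f : FreeNonUnitalNonAssocAlgebra Φ ℕ} :
    f ∈ (identities E n).toNonUnitalSubalgebra ↔
      ∀ (A : Type u) [NonUnitalNonAssocRing A] [Module Φ A]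
        [IsScalarTower Φ A A] [SMulCommClass Φ A A], InVariety E A →
        ∀ v : ℕ → A, (∀ i, n ≤ i → v i = 0) → FreeNonUnitalNonAssocAlgebra.lift Φ v f = 0 :=
  Iff.rfl

variable (Φ) in
/-- The endomorphism of the free algebra that kills all variables but the first `n`. -/
noncomputable def truncate (n : ℕ) : FreeNonUnitalNonAssocAlgebra Φ ℕ →ₙₐ[Φ] FreeNonUnitalNonAssocAlgebra Φ ℕ :=
  FreeNonUnitalNonAssocAlgebra.lift Φ
    fun i => if i < n then FreeNonUnitalNonAssocAlgebra.of Φ i else 0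

theorem truncate_monomial (n : ℕ) (w : FreeMagma ℕ) :
    truncate Φ n (monomial Φ w) = 0 ∨ truncate Φ n (monomial Φ w) = monomial Φ w := by
  induction w with
  | ih1 x =>
    rw [truncate, lift_monomial, FreeMagma.lift_of]
    by_cases h : x < n
    · rw [if_pos h]
      exact Or.inr (by simp [monomial])
    · rw [if_neg h]
      exact Or.inl rfl
  | ih2 x y hx hy =>
    rw [monomial_mul, map_mul]
    rcases hx with hx | hx
    · exact Or.inl (by rw [hx, zero_mul])
    · rcases hy with hy | hy
      · exact Or.inl (by rw [hy, mul_zero])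
      · exact Or.inr (by rw [hx, hy])

theorem truncate_homogComponent (n d : ℕ) (f : FreeNonUnitalNonAssocAlgebra Φ ℕ) :
    truncate Φ n (homogComponentₗ Φ d f) = homogComponentₗ Φ d (truncate Φ n f) := by
  have h : f ∈ Submodule.span Φ (Set.range (monomial Φ)) := by
    rw [span_range_monomial]; trivial
  induction h using Submodule.span_induction with
  | mem f hf =>
    obtain ⟨w, rfl⟩ := hf
    rcases truncate_monomial (Φ := Φ) n w with h | h
    · rw [h, homogComponent_monomial, map_zero]
      split_ifs
      · exact h
      · exact map_zero _
    · rw [h, homogComponent_monomial]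
      split_ifs
      · exact h
      · exact map_zero _
  | zero => simp
  | add f g _ _ hf hg => simp only [map_add, hf, hg]
  | smul c f _ hf => simp only [map_smul, hf]

theorem lift_truncate {n : ℕ} {v : ℕ → A} (hv : ∀ i, n ≤ i → v i = 0)
    (f : FreeNonUnitalNonAssocAlgebra Φ ℕ) :
    FreeNonUnitalNonAssocAlgebra.lift Φ v (truncate Φ n f) =
      FreeNonUnitalNonAssocAlgebra.lift Φ v f := by
  rw [truncate, comp_lift]
  congr 2
  funext i
  split_ifs with h
  · simp
  · rw [map_zero, hv i (not_lt.1 h)]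

/-- Membership tests only substitutions that vanish beyond the first `n` variables, while
homogeneity concerns identities in all variables. Truncation passes from the former to the latter
and commutes with taking components. -/
theorem homogComponent_mem_identities (hhom : IsHomogeneousVariety E) {n : ℕ}
    {f : FreeNonUnitalNonAssocAlgebra Φ ℕ} (hf : f ∈ (identities E n).toNonUnitalSubalgebra)
    (d : ℕ) : homogComponentₗ Φ d f ∈ (identities E n).toNonUnitalSubalgebra := by
  rw [mem_identities] at hf ⊢
  have h1 : IsIdentityOf E (truncate Φ n f) := by
    intro A _ _ _ _ hA v
    rw [truncate, comp_lift]
    refine hf A hA _ fun i hi => ?_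
    rw [if_neg (not_lt.2 hi), map_zero]
  intro A _ _ _ _ hA v hv
  rw [← lift_truncate hv, truncate_homogComponent]
  exact hhom _ h1 d A hA v

variable (E) in
/-- The relatively free algebra of the variety in `n` generators. -/
noncomputable abbrev RelFree (n : ℕ) : Type u := (identities E n).Quot

theorem inVariety_relFree (n : ℕ) : InVariety E (RelFree E n) := by
  intro f hf v
  choose v' hv' using fun i => (identities E n).proj_surjective (v i)
  have := comp_lift (identities E n).projHom v' f
  simp only [AlgIdeal.projHom_apply, hv'] at this
  rw [← this, AlgIdeal.proj_eq_zero, mem_identities]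
  intro A _ _ _ _ hA w hw
  rw [comp_lift]
  exact hA f hf _

variable (E) in
/-- The generators of the relatively free algebra. -/
noncomputable def relFreeGen (n : ℕ) (i : ℕ) : RelFree E n :=
  (identities E n).proj (FreeNonUnitalNonAssocAlgebra.of Φ i)

theorem relFreeGen_eq_zero {n i : ℕ} (h : n ≤ i) : relFreeGen E n i = 0 := by
  rw [relFreeGen, AlgIdeal.proj_eq_zero, mem_identities]
  intro A _ _ _ _ _ v hv
  rw [FreeNonUnitalNonAssocAlgebra.lift_of_apply, hv i h]

theorem proj_monomial (n : ℕ) (w : FreeMagma ℕ) :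
    (identities E n).proj (monomial Φ w) = FreeMagma.lift (relFreeGen E n) w := by
  rw [← AlgIdeal.projHom_apply, monomial, map_lift_word]
  rfl

theorem wordSpan_relFreeGen (n : ℕ) : wordSpan Φ (relFreeGen E n) Set.univ = ⊤ := by
  have := congrArg (Submodule.map (identities E n).proj) (span_range_monomial (Φ := Φ))
  rw [Submodule.map_span, Submodule.map_top,
    LinearMap.range_eq_top.2 (identities E n).proj_surjective, ← Set.range_comp] at this
  rw [← this, wordSpan, Set.image_univ]
  congr 2
  funext w
  exact (proj_monomial n w).symm

/-- A relation of the relatively free algebra which expresses a monomial through homogeneous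
elements holds, degree by degree, in all algebras of the variety. -/
theorem lift_mem_span_of_relFree (hhom : IsHomogeneousVariety E) {n : ℕ} {ι : Type*}
    {s : ι → FreeNonUnitalNonAssocAlgebra Φ ℕ} {deg : ι → ℕ}
    (hs : ∀ i d, homogComponentₗ Φ d (s i) = if deg i = d then s i else 0)
    {w : FreeMagma ℕ} (hw : FreeMagma.lift (relFreeGen E n) w ∈
      Submodule.span Φ (Set.range fun i => (identities E n).proj (s i)))
    (hA : InVariety E A) {v : ℕ → A} (hv : ∀ i, n ≤ i → v i = 0) :
    FreeMagma.lift v w ∈ Submodule.span Φ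
      ((fun i => FreeNonUnitalNonAssocAlgebra.lift Φ v (s i)) '' {i | deg i = w.length}) := by
  have h1 : Submodule.span Φ (Set.range fun i => (identities E n).proj (s i)) =
      (Submodule.span Φ (Set.range s)).map (identities E n).proj := by
    rw [Submodule.map_span, ← Set.range_comp]; rfl
  rw [h1] at hw
  obtain ⟨g, hg, hgw⟩ := hw
  rw [← proj_monomial] at hgw
  -- The relation between `g` and the monomial is itself an identity; only its component in the
  -- degree of `w` is kept.
  have h2 := homogComponent_mem_identities hhom ((AlgIdeal.proj_eq_proj _).1 hgw) w.length
  rw [map_sub, homogComponent_monomial, if_pos rfl, mem_identities] at h2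
  have h3 := h2 A hA v hv
  rw [map_sub, lift_monomial, sub_eq_zero] at h3
  rw [← h3]
  have h4 : Submodule.span Φ (Set.range s) ≤ (Submodule.span Φ
      ((fun i => FreeNonUnitalNonAssocAlgebra.lift Φ v (s i)) '' {i | deg i = w.length})).comap
      ((FreeNonUnitalNonAssocAlgebra.lift Φ v : _ →ₗ[Φ] A) ∘ₗ homogComponentₗ Φ w.length) := by
    rw [Submodule.span_le]
    rintro _ ⟨i, rfl⟩
    change FreeNonUnitalNonAssocAlgebra.lift Φ v (homogComponentₗ Φ w.length (s i)) ∈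
      Submodule.span Φ _
    rw [hs]
    split_ifs with h
    · exact Submodule.subset_span ⟨i, h, rfl⟩
    · rw [map_zero]; exact zero_mem _
  exact h4 hg

end Varieties

/-! ### Splitting long words -/

section LongWords

variable {Φ : Type u} [CommRing Φ] {E : Set (FreeNonUnitalNonAssocAlgebra Φ ℕ)}
variable {A : Type u} [NonUnitalNonAssocRing A] [Module Φ A]

theorem length_map_word {ι κ : Type*} (f : ι → κ) (w : FreeMagma ι) :
    (FreeMagma.map f w).length = w.length := by
  induction w with
  | ih1 x => rfl
  | ih2 x y hx hy =>
    rw [map_mul]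
    change _ + _ = _ + _
    rw [hx, hy]

theorem lift_eq_zero_or_exists_map {n : ℕ} {v : ℕ → A} (hv : ∀ i, n ≤ i → v i = 0)
    (w : FreeMagma ℕ) :
    FreeMagma.lift v w = 0 ∨ ∃ u : FreeMagma (Fin n), FreeMagma.map Fin.val u = w := by
  induction w with
  | ih1 x =>
    rcases lt_or_ge x n with h | h
    · exact Or.inr ⟨FreeMagma.of ⟨x, h⟩, rfl⟩
    · exact Or.inl (by rw [FreeMagma.lift_of, hv x h])
  | ih2 x y hx hy =>
    rcases hx with hx | ⟨a, rfl⟩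
    · exact Or.inl (by rw [map_mul, hx, zero_mul])
    · rcases hy with hy | ⟨b, rfl⟩
      · exact Or.inl (by rw [map_mul, hy, mul_zero])
      · exact Or.inr ⟨a * b, map_mul _ _ _⟩

theorem wordSpan_fin_eq_top {n : ℕ} {v : ℕ → A} (hv : ∀ i, n ≤ i → v i = 0)
    (h : wordSpan Φ v Set.univ = ⊤) : wordSpan Φ (fun i : Fin n => v i) Set.univ = ⊤ := by
  rw [eq_top_iff, ← h]
  refine wordSpan_le fun w _ => ?_
  rcases lift_eq_zero_or_exists_map hv w with h | ⟨u, rfl⟩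
  · rw [h]; exact zero_mem _
  · rw [lift_map_word]
    exact lift_mem_wordSpan (Set.mem_univ u)

variable [IsScalarTower Φ A A] [SMulCommClass Φ A A]

/-- In a locally admissible variety, long words in a finite set of generators lie in the square of
the attached Jordan algebra. -/
theorem exists_lift_mem_jordanSq (htwo : IsUnit (2 : Φ)) (hadm : IsLocallyAdmissible E)
    (hA : InVariety E A) {n : ℕ} (v : Fin n → A) :
    ∃ c, ∀ w : FreeMagma (Fin n), c ≤ w.length →
      FreeMagma.lift v w ∈ jordanSq (jordanMul Φ A) := by
  have hJ := hadm.1 A hA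
  let I : AlgIdeal Φ A := AlgIdeal.ofSubmodule (jordanSq (jordanMul Φ A))
    (fun a x hx => (hJ.mul_mem_jordanSq htwo hx a).2)
    (fun x a hx => (hJ.mul_mem_jordanSq htwo hx a).1)
  have hanti : IsAnticomm I.Quot := by
    intro x y
    obtain ⟨a, rfl⟩ := I.proj_surjective x
    obtain ⟨b, rfl⟩ := I.proj_surjective y
    rw [eq_neg_iff_add_eq_zero, ← I.proj_mul, ← I.proj_mul, ← map_add, AlgIdeal.proj_eq_zero]
    exact mul_mem_jordanSq a b
  have hnil := hadm.2 I.Quot (hA.of_surjective I.projHom I.proj_surjective) hanti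
  obtain ⟨c, k, hc⟩ := (isLocallyNilpotentAlg_iff Φ I.Quot).1 hnil n fun i => I.projHom (v i)
  refine ⟨c, fun w hw => ?_⟩
  have := hc w hw
  rw [Submodule.bot_smul, Submodule.mem_bot, ← map_lift_word] at this
  exact AlgIdeal.proj_eq_zero.1 this

/-- In a locally admissible homogeneous variety, a long word is a combination of Jordan products
of words of the same total degree. -/
theorem exists_lift_mem_jordanProducts (htwo : IsUnit (2 : Φ)) (hhom : IsHomogeneousVariety E)
    (hadm : IsLocallyAdmissible E) (n : ℕ) :
    ∃ c, ∀ (A : Type u) [NonUnitalNonAssocRing A] [Module Φ A]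
      [IsScalarTower Φ A A] [SMulCommClass Φ A A], InVariety E A →
      ∀ v : ℕ → A, (∀ i, n ≤ i → v i = 0) → ∀ w : FreeMagma ℕ, c ≤ w.length →
      FreeMagma.lift v w ∈ Submodule.span Φ
        ((fun p : FreeMagma ℕ × FreeMagma ℕ =>
          jordanMul Φ A (FreeMagma.lift v p.1) (FreeMagma.lift v p.2)) ''
          {p | p.1.length + p.2.length = w.length}) := by
  -- Working in the relatively free algebra makes `c` depend on `n` alone and not on the algebra or
  -- the family.
  obtain ⟨c, hc⟩ := exists_lift_mem_jordanSq htwo hadm (inVariety_relFree (E := E) n)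
    (fun i : Fin n => relFreeGen E n i)
  refine ⟨c, fun A _ _ _ _ hA v hv w hw => ?_⟩
  let s : FreeMagma ℕ × FreeMagma ℕ → FreeNonUnitalNonAssocAlgebra Φ ℕ :=
    fun p => monomial Φ (p.1 * p.2) + monomial Φ (p.2 * p.1)
  have key := lift_mem_span_of_relFree (E := E) hhom (n := n) (s := s)
    (deg := fun p => p.1.length + p.2.length) (w := w) ?_ ?_ hA hv
  · refine Submodule.span_mono ?_ key
    rintro _ ⟨p, hp, rfl⟩
    refine ⟨p, hp, ?_⟩
    simp only [s, map_add, lift_monomial, map_mul, jordanMul_apply]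
  · intro p d
    simp only [s, map_add, homogComponent_monomial]
    have h1 : (p.1 * p.2).length = p.1.length + p.2.length := rfl
    have h2 : (p.2 * p.1).length = p.1.length + p.2.length := add_comm _ _
    rw [h1, h2]
    split_ifs
    · rfl
    · exact add_zero 0
  · rcases lift_eq_zero_or_exists_map (fun i => relFreeGen_eq_zero (E := E) (n := n)) w
      with h | ⟨u, rfl⟩
    · rw [h]; exact zero_mem _
    · rw [length_map_word] at hw
      rw [lift_map_word]
      have h := hc u hw
      rw [jordanSq, ← wordSpan_relFreeGen, wordSpan, Submodule.map₂_span_span] at h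
      refine Submodule.span_mono ?_ h
      rintro _ ⟨_, ⟨a, -, rfl⟩, _, ⟨b, -, rfl⟩, rfl⟩
      refine ⟨(a, b), ?_⟩
      simp only [s, map_add, proj_monomial, map_mul, jordanMul_apply]

/-- The words of length `d` that are products of two words of length at least `2`. -/
def splitWords (ι : Type*) (d : ℕ) : Set (FreeMagma ι) :=
  {u | u.length = d ∧ ∃ a b : FreeMagma ι, 2 ≤ a.length ∧ 2 ≤ b.length ∧ a * b = u}

/-- In a locally admissible homogeneous variety, a long word is a combination of words of the
same length, each being a product of two words of length at least `2`. -/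
theorem exists_lift_mem_splitWords (htwo : IsUnit (2 : Φ)) (hhom : IsHomogeneousVariety E)
    (hadm : IsLocallyAdmissible E) (n : ℕ) :
    ∃ c, ∀ (A : Type u) [NonUnitalNonAssocRing A] [Module Φ A]
      [IsScalarTower Φ A A] [SMulCommClass Φ A A], InVariety E A →
      ∀ (v : Fin n → A) (w : FreeMagma (Fin n)), c ≤ w.length →
      FreeMagma.lift v w ∈ wordSpan Φ v (splitWords (Fin n) w.length) := by
  have hQ := inVariety_relFree (E := E) n
  have hg : ∀ i, n ≤ i → relFreeGen E n i = 0 := fun i => relFreeGen_eq_zero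
  obtain ⟨c₁, h₁⟩ := exists_lift_mem_jordanSq htwo hadm hQ (fun i : Fin n => relFreeGen E n i)
  obtain ⟨c₂, h₂⟩ := exists_lift_mem_jordanProducts htwo hhom hadm n
  let G : ℕ → Submodule Φ (RelFree E n) := fun d => wordSpan Φ (relFreeGen E n) {w | w.length = d}
  have hG : ∀ i j, ∀ x ∈ G i, ∀ y ∈ G j, jordanMul Φ _ x y ∈ G (i + j) := by
    intro i j x hx y hy
    rw [jordanMul_apply]
    refine add_mem (mul_mem_wordSpan ?_ hx hy) (mul_mem_wordSpan ?_ hy hx)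
    · rintro a rfl b rfl; rfl
    · rintro a rfl b rfl; exact add_comm _ _
  have hgen : ∀ d, c₂ ≤ d → G d ≤ ⨆ p : {p : ℕ × ℕ // 0 < p.1 ∧ 0 < p.2 ∧ p.1 + p.2 = d},
      Submodule.map₂ (jordanMul Φ _) (G p.1.1) (G p.1.2) := by
    intro d hd
    refine wordSpan_le fun w hw => ?_
    obtain rfl : w.length = d := hw
    refine Submodule.span_le.2 ?_ (h₂ _ hQ _ hg w hd)
    rintro _ ⟨p, hp, rfl⟩
    refine Submodule.mem_iSup_of_mem
      ⟨(p.1.length, p.2.length), p.1.length_pos, p.2.length_pos, hp⟩ ?_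
    refine Submodule.apply_mem_map₂ _ ?_ ?_
    · exact lift_mem_wordSpan (show p.1.length = p.1.length from rfl)
    · exact lift_mem_wordSpan (show p.2.length = p.2.length from rfl)
  -- Words of length at least `c₁` lie in the square, and only finitely many are shorter.
  have htop : jordanSq (jordanMul Φ (RelFree E n)) ⊔
      wordSpan Φ (fun i : Fin n => relFreeGen E n i) {u | u.length ≤ c₁} = ⊤ := by
    rw [eq_top_iff, ← wordSpan_fin_eq_top hg (wordSpan_relFreeGen n)]
    refine wordSpan_le fun w _ => ?_
    rcases le_total c₁ w.length with h | h
    · exact Submodule.mem_sup_left (h₁ w h)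
    · exact Submodule.mem_sup_right (lift_mem_wordSpan h)
  obtain ⟨c, hc⟩ := ((hadm.1 _ hQ).isJordanProduct htwo).exists_le_jordanSqSq htwo hG hgen
    (wordSpan_fg _ _) htop
  refine ⟨c, fun A _ _ _ _ hA v w hw => ?_⟩
  let v' : ℕ → A := fun i => if h : i < n then v ⟨i, h⟩ else 0
  have hv' : ∀ i, n ≤ i → v' i = 0 := fun i hi => dif_neg (not_lt.2 hi)
  have hvv : (fun i : Fin n => v' i) = v := by
    funext i
    simp [v']
  -- No degree is prescribed here: the square of the square gives products of words of length at
  -- least 2 of any total length, and homogeneity restores the length of `w`.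
  let s : {p : FreeMagma ℕ × FreeMagma ℕ // 2 ≤ p.1.length ∧ 2 ≤ p.2.length} →
    FreeNonUnitalNonAssocAlgebra Φ ℕ := fun p => monomial Φ (p.1.1 * p.1.2)
  have key := lift_mem_span_of_relFree (E := E) hhom (n := n) (s := s)
    (deg := fun p => (p.1.1 * p.1.2).length) (w := FreeMagma.map Fin.val w) ?_ ?_ hA hv'
  · rw [lift_map_word, hvv, length_map_word] at key
    refine Submodule.span_le.2 ?_ key
    rintro _ ⟨⟨⟨a, b⟩, ha, hb⟩, hp, rfl⟩
    simp only [s, lift_monomial, SetLike.mem_coe, map_mul]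
    rcases lift_eq_zero_or_exists_map hv' a with h | ⟨a, rfl⟩
    · rw [h, zero_mul]; exact zero_mem _
    · rcases lift_eq_zero_or_exists_map hv' b with h | ⟨b, rfl⟩
      · rw [h, mul_zero]; exact zero_mem _
      · rw [lift_map_word, lift_map_word, hvv, ← map_mul]
        simp only [length_map_word] at ha hb
        refine lift_mem_wordSpan ⟨?_, a, b, ha, hb, rfl⟩
        simpa only [Set.mem_ofPred_eq, ← map_mul, length_map_word] using hp
  · intro p d
    exact homogComponent_monomial d _
  · have h := hc _ hw (lift_mem_wordSpan (v := relFreeGen E n) (w := FreeMagma.map Fin.val w)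
      (length_map_word _ w))
    have hD : jordanSq (jordanMul Φ (RelFree E n)) ≤
        wordSpan Φ (relFreeGen E n) {u | 2 ≤ u.length} := by
      refine Submodule.map₂_le.2 fun x _ y _ => ?_
      have htop := wordSpan_relFreeGen (E := E) n
      have : ∀ x y : RelFree E n, x * y ∈ wordSpan Φ (relFreeGen E n) {u | 2 ≤ u.length} := by
        intro x y
        refine mul_mem_wordSpan ?_ (htop ▸ Submodule.mem_top : x ∈ _)
          (htop ▸ Submodule.mem_top : y ∈ _)
        intro a _ b _
        have ha := a.length_pos
        have hb := b.length_pos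
        change 2 ≤ a.length + b.length
        omega
      exact add_mem (this x y) (this y x)
    have hK : jordanSqSq (jordanMul Φ (RelFree E n)) ≤
        Submodule.span Φ (Set.range fun i => (identities E n).proj (s i)) := by
      refine Submodule.map₂_le.2 fun x hx y hy => ?_
      have : ∀ x ∈ wordSpan Φ (relFreeGen E n) {u | 2 ≤ u.length},
          ∀ y ∈ wordSpan Φ (relFreeGen E n) {u | 2 ≤ u.length},
          x * y ∈ Submodule.span Φ (Set.range fun i => (identities E n).proj (s i)) := by
        intro x hx y hy
        refine mul_mem_of_span ?_ hx hy
        rintro _ ⟨a, ha, rfl⟩ _ ⟨b, hb, rfl⟩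
        refine Submodule.subset_span ⟨⟨(a, b), ha, hb⟩, ?_⟩
        simp only [s, proj_monomial, map_mul]
      exact add_mem (this x (hD hx) y (hD hy)) (this y (hD hy) x (hD hx))
    exact hK h

end LongWords

/-! ### The extension property -/

section Extension

variable {Φ : Type u} [CommRing Φ] {E : Set (FreeNonUnitalNonAssocAlgebra Φ ℕ)}
variable {A : Type u} [NonUnitalNonAssocRing A] [Module Φ A]
  [IsScalarTower Φ A A] [SMulCommClass Φ A A]
variable {C : Type u} [NonUnitalNonAssocRing C] [Module Φ C]

/-- The span of all words in `v` is stable under products. -/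
theorem mul_mem_wordSpan_univ {ι : Type*} {v : ι → A} {x y : A}
    (hx : x ∈ wordSpan Φ v Set.univ) (hy : y ∈ wordSpan Φ v Set.univ) :
    x * y ∈ wordSpan Φ v Set.univ :=
  mul_mem_wordSpan (fun _ _ _ _ => Set.mem_univ _) hx hy

theorem lift_mem_wordSpan_univ {ι κ : Type*} {v : ι → A} {y : κ → A}
    (h : ∀ j, y j ∈ wordSpan Φ v Set.univ) (w : FreeMagma κ) :
    FreeMagma.lift y w ∈ wordSpan Φ v Set.univ := by
  induction w with
  | ih1 x => exact h x
  | ih2 a b ha hb => rw [map_mul]; exact mul_mem_wordSpan_univ ha hb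

theorem wordSpan_univ_le_of_forall {ι κ : Type*} {v : ι → A} {y : κ → A}
    (h : ∀ j, y j ∈ wordSpan Φ v Set.univ) (s : Set (FreeMagma κ)) :
    wordSpan Φ y s ≤ wordSpan Φ v Set.univ :=
  wordSpan_le fun w _ => lift_mem_wordSpan_univ h w

/-- An enumeration of a finite set of words. -/
theorem exists_enum {ι : Type*} {s : Set (FreeMagma ι)} (hs : s.Finite) :
    ∃ (r : ℕ) (u : Fin r → FreeMagma ι), Set.range u = s := by
  obtain ⟨r, u, hu⟩ := hs.fin_embedding
  exact ⟨r, u, hu⟩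

/-- The value of every word is, modulo the finitely generated submodule `N`, in the subalgebra
generated by `t`. -/
theorem wordSpan_le_sup {n r : ℕ} {a : Fin n → A} {t : Fin r → A} {c : ℕ}
    (hc : ∀ w : FreeMagma (Fin n), c ≤ w.length →
      FreeMagma.lift a w ∈ wordSpan Φ a (splitWords (Fin n) w.length))
    (ht : ∀ w : FreeMagma (Fin n), w.length ≤ max c 2 → FreeMagma.lift a w ∈
      Submodule.span Φ (Set.range a) ⊔ wordSpan Φ t Set.univ) (w : FreeMagma (Fin n)) :
    FreeMagma.lift a w ∈ Submodule.span Φ (Set.range a) ⊔ wordSpan Φ t Set.univ := by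
  obtain ⟨d, hd⟩ : ∃ d, w.length = d := ⟨_, rfl⟩
  induction d using Nat.strong_induction_on generalizing w with
  | _ d ih =>
  set M := Submodule.span Φ (Set.range a) ⊔ wordSpan Φ t Set.univ with hM
  rcases le_or_gt w.length (max c 2) with h | h
  · exact ht w h
  have hM' : ∀ u : FreeMagma (Fin n), u.length < d → FreeMagma.lift a u ∈ M :=
    fun u hu => ih _ hu u rfl
  refine wordSpan_le ?_ (hc w (by omega))
  rintro _ ⟨hl, p, q, hp, hq, rfl⟩
  have hl' : p.length + q.length = d := hl.trans hd
  have ha : ∀ x ∈ Submodule.span Φ (Set.range a), ∀ y ∈ Submodule.span Φ (Set.range a),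
      x * y ∈ M := by
    intro x hx y hy
    refine mul_mem_of_span ?_ hx hy
    rintro _ ⟨i, rfl⟩ _ ⟨j, rfl⟩
    exact ht (FreeMagma.of i * FreeMagma.of j) (le_max_right _ _)
  have h1 : ∀ x ∈ Submodule.span Φ (Set.range a), x * FreeMagma.lift a q ∈ M := by
    intro x hx
    have : Submodule.span Φ (Set.range a) ≤ M.comap ((LinearMap.mul Φ A).flip
        (FreeMagma.lift a q)) := by
      rw [Submodule.span_le]
      rintro _ ⟨i, rfl⟩
      have := hM' (FreeMagma.of i * q) (show 1 + q.length < d by omega)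
      rwa [map_mul, FreeMagma.lift_of] at this
    exact this hx
  have h2 : ∀ y ∈ Submodule.span Φ (Set.range a), FreeMagma.lift a p * y ∈ M := by
    intro y hy
    have : Submodule.span Φ (Set.range a) ≤ M.comap (LinearMap.mul Φ A
        (FreeMagma.lift a p)) := by
      rw [Submodule.span_le]
      rintro _ ⟨i, rfl⟩
      have := hM' (p * FreeMagma.of i) (show p.length + 1 < d by omega)
      rwa [map_mul, FreeMagma.lift_of] at this
    exact this hy
  obtain ⟨x, hx, x', hx', hxe⟩ := Submodule.mem_sup.1 (hM' p (by omega))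
  obtain ⟨y, hy, y', hy', hye⟩ := Submodule.mem_sup.1 (hM' q (by omega))
  -- The mixed terms replace a factor of length at least 2 by single letters, so they involve
  -- strictly shorter words; `x * y` involves only words of length 2, whence the bound `max c 2`.
  have e : FreeMagma.lift a (p * q) =
      x' * y' + x * FreeMagma.lift a q + FreeMagma.lift a p * y - x * y := by
    rw [map_mul, ← hxe, ← hye]
    simp only [add_mul, mul_add]
    abel
  rw [e]
  exact sub_mem (add_mem (add_mem (Submodule.mem_sup_right (mul_mem_wordSpan_univ hx' hy'))
    (h1 x hx)) (h2 y hy)) (ha x hx y hy)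

/-- The extension property for finiteness as a module. -/
theorem exists_wordSpan_univ_le (htwo : IsUnit (2 : Φ)) (hhom : IsHomogeneousVariety E)
    (hadm : IsLocallyAdmissible E) (hA : InVariety E A) {Z : Ideal Φ} (φ : A →ₙₐ[Φ] C) {n : ℕ}
    {v : Fin n → A} (hv : IsFiniteFamily Φ Z fun i => φ (v i))
    (hker : ∀ (r : ℕ) (t : Fin r → A), (∀ i, φ (t i) = 0) → IsFiniteFamily Φ Z t) :
    ∃ k, wordSpan Φ v Set.univ ≤ wordSpan Φ v {u | u.length ≤ k} := by
  obtain ⟨m, k, h⟩ := hv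
  let K := max m k
  -- The `+ 1` ensures that the letters themselves are among these words even if `K = 0`.
  obtain ⟨n', u, hu⟩ := exists_enum (finite_length_le (ι := Fin n) (K + 1))
  let a : Fin n' → A := fun i => FreeMagma.lift v (u i)
  have hspan : Submodule.span Φ (Set.range a) = wordSpan Φ v {u | u.length ≤ K + 1} := by
    rw [wordSpan, ← hu, ← Set.range_comp]; rfl
  have hred : ∀ w : FreeMagma (Fin n), ∃ t, φ t = 0 ∧
      FreeMagma.lift v w - t ∈ Submodule.span Φ (Set.range a) := by
    intro w
    rw [hspan]
    rcases le_total m w.length with hw | hw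
    · have := h w hw
      rw [← map_lift_word, ← map_wordSpan, ← Submodule.map_smul''] at this
      obtain ⟨x, hx, hxe⟩ := this
      refine ⟨FreeMagma.lift v w - x, ?_, ?_⟩
      · rw [map_sub, sub_eq_zero]; exact hxe.symm
      · rw [sub_sub_cancel]
        refine wordSpan_mono v (fun u hu => ?_) (Submodule.smul_le_right hx)
        have h1 : u.length ≤ k := hu
        have h2 : k ≤ K := le_max_right _ _
        change u.length ≤ K + 1
        omega
    · refine ⟨0, map_zero _, ?_⟩
      rw [sub_zero]
      refine lift_mem_wordSpan ?_
      have h2 : m ≤ K := le_max_left _ _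
      change w.length ≤ K + 1
      omega
  have ha : ∀ i, a i ∈ wordSpan Φ v Set.univ := fun i => lift_mem_wordSpan (Set.mem_univ _)
  have hred' : ∀ w : FreeMagma (Fin n'), ∃ t, φ t = 0 ∧
      FreeMagma.lift a w - t ∈ Submodule.span Φ (Set.range a) := by
    intro w
    have : FreeMagma.lift a w ∈ wordSpan Φ v Set.univ := lift_mem_wordSpan_univ ha w
    have hle : wordSpan Φ v Set.univ ≤
        LinearMap.ker (φ : A →ₗ[Φ] C) ⊔ Submodule.span Φ (Set.range a) := by
      refine wordSpan_le fun w _ => ?_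
      obtain ⟨t, ht, ht'⟩ := hred w
      rw [← add_sub_cancel t (FreeMagma.lift v w)]
      exact Submodule.add_mem_sup ht ht'
    obtain ⟨t, ht, y, hy, he⟩ := Submodule.mem_sup.1 (hle this)
    refine ⟨t, ht, ?_⟩
    rw [← he, add_sub_cancel_left]
    exact hy
  choose τ hτ hτ' using hred'
  obtain ⟨c, hc⟩ := exists_lift_mem_splitWords htwo hhom hadm n'
  obtain ⟨r, x, hx⟩ := exists_enum (finite_length_le (ι := Fin n') (max c 2))
  -- Kernel parts of the finitely many short words in `a`; by `wordSpan_le_sup` they account for all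
  -- words in `a` modulo the span of `a`.
  let t : Fin r → A := fun i => τ (x i)
  obtain ⟨m₁, k₁, hT⟩ := hker r t fun i => hτ (x i)
  have hle := wordSpan_le_sup (a := a) (t := t) (hc A hA a) (fun w hw => by
    obtain ⟨i, rfl⟩ : w ∈ Set.range x := hx ▸ hw
    rw [← sub_add_cancel (FreeMagma.lift a (x i)) (τ (x i))]
    refine Submodule.add_mem_sup (hτ' _) ?_
    exact lift_mem_wordSpan (v := t) (Set.mem_univ (FreeMagma.of i)))
  have hT' : wordSpan Φ t Set.univ ≤ wordSpan Φ t {u | u.length ≤ max m₁ k₁} := by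
    refine wordSpan_le fun w _ => ?_
    rcases le_total m₁ w.length with hw | hw
    · refine wordSpan_mono t (fun u hu => ?_) (Submodule.smul_le_right (hT w hw))
      exact (show u.length ≤ k₁ from hu).trans (le_max_right _ _)
    · exact lift_mem_wordSpan (show w.length ≤ max m₁ k₁ from hw.trans (le_max_left _ _))
  have ht : ∀ i, t i ∈ wordSpan Φ v Set.univ := fun i => by
    rw [← sub_sub_cancel (FreeMagma.lift a (x i)) (t i)]
    refine sub_mem (lift_mem_wordSpan_univ ha _) ?_
    exact Submodule.span_le.2 (by rintro _ ⟨j, rfl⟩; exact ha j) (hτ' (x i))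
  obtain ⟨k', hk'⟩ := exists_fg_le_wordSpan v
    (N := Submodule.span Φ (Set.range a) ⊔ wordSpan Φ t {u | u.length ≤ max m₁ k₁})
    ((Submodule.fg_span (Set.finite_range a)).sup (wordSpan_fg t _))
    (sup_le (Submodule.span_le.2 (by rintro _ ⟨j, rfl⟩; exact ha j))
      (wordSpan_univ_le_of_forall ht _))
  refine ⟨k', wordSpan_le fun w _ => hk' ?_⟩
  have hva : ∀ i, v i ∈ wordSpan Φ a Set.univ := fun i => by
    obtain ⟨j, hj⟩ : FreeMagma.of i ∈ Set.range u := hu ▸ (show 1 ≤ K + 1 by omega)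
    have : v i = FreeMagma.lift a (FreeMagma.of j) := by
      rw [FreeMagma.lift_of]
      change v i = FreeMagma.lift v (u j)
      rw [hj, FreeMagma.lift_of]
    rw [this]
    exact lift_mem_wordSpan (Set.mem_univ _)
  exact sup_le_sup_left hT' _ (wordSpan_le (fun w _ => hle w) (lift_mem_wordSpan_univ hva w))

/-- Long words in `v` are combinations of long words in a finite family of words of length at
least `2 ^ r` in `v`. -/
theorem exists_derived_family (htwo : IsUnit (2 : Φ)) (hhom : IsHomogeneousVariety E)
    (hadm : IsLocallyAdmissible E) (hA : InVariety E A) (r : ℕ) {n : ℕ} (v : Fin n → A) :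
    ∃ (n' c : ℕ) (u : Fin n' → FreeMagma (Fin n)), 0 < c ∧ (∀ i, 2 ^ r ≤ (u i).length) ∧
      ∀ d, 1 ≤ d → ∀ w : FreeMagma (Fin n), c * d ≤ w.length →
        FreeMagma.lift v w ∈ wordSpan Φ (fun i => FreeMagma.lift v (u i)) {x | d ≤ x.length} := by
  induction r generalizing n with
  | zero =>
    refine ⟨n, 1, FreeMagma.of, one_pos, fun i => le_rfl, fun d _ w hw => ?_⟩
    rw [one_mul] at hw
    simp only [FreeMagma.lift_of]
    exact lift_mem_wordSpan hw
  | succ r ih =>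
    obtain ⟨c, hc⟩ := exists_lift_mem_splitWords htwo hhom hadm n
    obtain ⟨n₁, u, hu⟩ := exists_enum
      (s := {w : FreeMagma (Fin n) | 2 ≤ w.length ∧ w.length ≤ c + 1})
      ((finite_length_le (c + 1)).subset fun w hw => hw.2)
    let v₁ : Fin n₁ → A := fun i => FreeMagma.lift v (u i)
    -- Splitting is repeated until all factors have length between 2 and `c + 1`; total length is
    -- preserved, so the number of factors is at least the length of `w` divided by `c + 1`.
    have h₁ : ∀ w : FreeMagma (Fin n), 2 ≤ w.length →
        FreeMagma.lift v w ∈ wordSpan Φ v₁ {x | w.length ≤ (c + 1) * x.length} := by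
      intro w
      obtain ⟨d, hd⟩ : ∃ d, w.length = d := ⟨_, rfl⟩
      induction d using Nat.strong_induction_on generalizing w with
      | _ d ihd =>
      intro hw
      rcases le_or_gt w.length (c + 1) with h | h
      · obtain ⟨i, rfl⟩ : w ∈ Set.range u := hu ▸ ⟨hw, h⟩
        exact lift_mem_wordSpan (v := v₁) (w := FreeMagma.of i)
          (show (u i).length ≤ (c + 1) * 1 by omega)
      · refine wordSpan_le ?_ (hc A hA v w (by omega))
        rintro _ ⟨hl, p, q, hp, hq, rfl⟩
        have hl' : p.length + q.length = w.length := hl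
        rw [map_mul]
        refine mul_mem_wordSpan ?_ (ihd _ (by omega) p rfl hp) (ihd _ (by omega) q rfl hq)
        intro x hx y hy
        change w.length ≤ (c + 1) * (x.length + y.length)
        have hx' : p.length ≤ (c + 1) * x.length := hx
        have hy' : q.length ≤ (c + 1) * y.length := hy
        rw [mul_add]
        omega
    obtain ⟨n₂, c₂, u₂, hc₂, hu₂, h₂⟩ := ih v₁
    have hsub : ∀ w : FreeMagma (Fin n₁), FreeMagma.lift v₁ w =
        FreeMagma.lift v (FreeMagma.lift u w) := by
      intro w
      induction w with
      | ih1 x => rfl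
      | ih2 x y hx hy => simp only [map_mul, hx, hy]
    have hlen : ∀ w : FreeMagma (Fin n₁), 2 * w.length ≤ (FreeMagma.lift u w).length := by
      intro w
      induction w with
      | ih1 x =>
        have : u x ∈ Set.range u := ⟨x, rfl⟩
        rw [hu] at this
        exact this.1
      | ih2 x y hx hy =>
        rw [map_mul]
        change 2 * (x.length + y.length) ≤
          (FreeMagma.lift u x).length + (FreeMagma.lift u y).length
        omega
    -- The final `+ 1` forces the length of `w` to be at least 2, as `h₁` requires.
    refine ⟨n₂, (c + 1) * c₂ + 1, fun i => FreeMagma.lift u (u₂ i), by omega, fun i => ?_,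
      fun d hd w hw => ?_⟩
    · have := hlen (u₂ i)
      have := hu₂ i
      change 2 ^ (r + 1) ≤ (FreeMagma.lift u (u₂ i)).length
      rw [pow_succ]
      omega
    · simp only [← hsub]
      have hpos : 1 ≤ (c + 1) * c₂ * d := Nat.mul_pos (Nat.mul_pos (by omega) hc₂) hd
      rw [add_mul, one_mul] at hw
      refine wordSpan_le ?_ (h₁ w (by omega))
      intro x hx
      refine h₂ d hd x ?_
      have hx' : w.length ≤ (c + 1) * x.length := hx
      have : (c + 1) * (c₂ * d) ≤ (c + 1) * x.length := by
        rw [← mul_assoc]; omega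
      exact Nat.le_of_mul_le_mul_left this (by omega)

/-- The extension property: if the image of a finite family under a homomorphism and all finite
families in the kernel generate subalgebras that are finite over `Z`, so does the family. -/
theorem IsFiniteFamily.of_extension (htwo : IsUnit (2 : Φ)) (hhom : IsHomogeneousVariety E)
    (hadm : IsLocallyAdmissible E) (hA : InVariety E A) {Z : Ideal Φ} (φ : A →ₙₐ[Φ] C) {n : ℕ}
    {v : Fin n → A} (hv : IsFiniteFamily Φ Z fun i => φ (v i))
    (hker : ∀ (r : ℕ) (t : Fin r → A), (∀ i, φ (t i) = 0) → IsFiniteFamily Φ Z t) :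
    IsFiniteFamily Φ Z v := by
  obtain ⟨K, hK⟩ := exists_wordSpan_univ_le htwo hhom hadm hA φ hv hker
  obtain ⟨m, k, h⟩ := hv
  -- The exponent `m` suffices because 2 ^ m ≥ m: the images of the words `u i` then have
  -- coefficients in `Z`.
  obtain ⟨n', c, u, hc, hu, hd⟩ := exists_derived_family htwo hhom hadm hA m v
  set B := wordSpan Φ v Set.univ with hB
  have hred : ∀ i, ∃ t, φ t = 0 ∧ FreeMagma.lift v (u i) - t ∈ Z • B := by
    intro i
    have := h (u i) ((Nat.lt_two_pow_self).le.trans (hu i))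
    rw [← map_lift_word, ← map_wordSpan, ← Submodule.map_smul''] at this
    obtain ⟨x, hx, hxe⟩ := this
    refine ⟨FreeMagma.lift v (u i) - x, ?_, ?_⟩
    · rw [map_sub, sub_eq_zero]; exact hxe.symm
    · rw [sub_sub_cancel]
      exact Submodule.smul_mono le_rfl (wordSpan_mono v (Set.subset_univ _)) hx
  choose t ht ht' using hred
  obtain ⟨m₁, k₁, hT⟩ := hker n' t ht
  have hv₁B : ∀ i, FreeMagma.lift v (u i) ∈ B := fun i => lift_mem_wordSpan (Set.mem_univ _)
  have htB : ∀ i, t i ∈ B := fun i => by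
    rw [← sub_sub_cancel (FreeMagma.lift v (u i)) (t i)]
    exact sub_mem (hv₁B i) (Submodule.smul_le_right (ht' i))
  have hl : ∀ x ∈ Z • B, ∀ y ∈ B, x * y ∈ Z • B := by
    intro x hx y hy
    refine Submodule.smul_induction_on hx (fun z hz b hb => ?_) fun a b ha hb => ?_
    · rw [smul_mul_assoc]
      exact Submodule.smul_mem_smul hz (mul_mem_wordSpan_univ hb hy)
    · rw [add_mul]; exact add_mem ha hb
  have hr : ∀ x ∈ Z • B, ∀ y ∈ B, y * x ∈ Z • B := by
    intro x hx y hy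
    refine Submodule.smul_induction_on hx (fun z hz b hb => ?_) fun a b ha hb => ?_
    · rw [mul_smul_comm]
      exact Submodule.smul_mem_smul hz (mul_mem_wordSpan_univ hy hb)
    · rw [mul_add]; exact add_mem ha hb
  -- `Z • B` absorbs products with elements of `B`, so replacing every letter by its kernel part
  -- does not matter modulo `Z • B`.
  have hdiff : ∀ w : FreeMagma (Fin n'),
      FreeMagma.lift (fun i => FreeMagma.lift v (u i)) w - FreeMagma.lift t w ∈ Z • B := by
    intro w
    induction w with
    | ih1 i => exact ht' i
    | ih2 x y hx hy =>
      have e : ∀ a b a' b' : A, a * b - a' * b' = (a - a') * b + a' * (b - b') := by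
        intro a b a' b'
        rw [sub_mul, mul_sub]; abel
      rw [map_mul, map_mul, e]
      exact add_mem (hl _ hx _ (lift_mem_wordSpan_univ hv₁B y))
        (hr _ hy _ (lift_mem_wordSpan_univ htB x))
  refine ⟨c * (m₁ + 1), K, fun w hw => ?_⟩
  refine Submodule.smul_mono le_rfl hK ?_
  refine wordSpan_le ?_ (hd (m₁ + 1) (by omega) w hw)
  intro x hx
  rw [← sub_add_cancel (FreeMagma.lift _ x) (FreeMagma.lift t x)]
  refine add_mem (hdiff x) ?_
  exact Submodule.smul_mono le_rfl (wordSpan_univ_le_of_forall htB _)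
    (hT x (by have : m₁ + 1 ≤ x.length := hx; omega))

end Extension

/-! ### Construction of the radical -/

section Radical

variable {Φ : Type u} [CommRing Φ] {E : Set (FreeNonUnitalNonAssocAlgebra Φ ℕ)}
variable {A : Type u} [NonUnitalNonAssocRing A] [Module Φ A] {Z : Ideal Φ}

theorem isLocallyFinite_subalgebra_iff {B : NonUnitalSubalgebra Φ A} :
    IsLocallyFinite Φ Z B ↔
      ∀ (n : ℕ) (v : Fin n → A), (∀ i, v i ∈ B) → IsFiniteFamily Φ Z v := by
  constructor
  · intro h n v hv
    exact (h n fun i => ⟨v i, hv i⟩).map (NonUnitalSubalgebraClass.subtype B)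
  · intro h n v
    exact IsFiniteFamily.of_map (NonUnitalSubalgebraClass.subtype B) Subtype.val_injective
      (h n (fun i => (v i : A)) fun i => (v i).2)

theorem IsLocallyFinite.of_surjective {C : Type u} [NonUnitalNonAssocRing C] [Module Φ C]
    (h : IsLocallyFinite Φ Z A) (φ : A →ₙₐ[Φ] C) (hφ : Function.Surjective φ) :
    IsLocallyFinite Φ Z C := by
  intro n v
  choose v' hv' using fun i => hφ (v i)
  have := (h n v').map φ
  simpa only [hv'] using this

variable [IsScalarTower Φ A A] [SMulCommClass Φ A A]
variable (htwo : IsUnit (2 : Φ)) (hhom : IsHomogeneousVariety E) (hadm : IsLocallyAdmissible E)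
include htwo hhom hadm

/-- An extension of a locally finite ideal by a locally finite algebra is locally finite. -/
theorem IsLocallyFinite.of_extension (hA : InVariety E A) {I : AlgIdeal Φ A}
    (hI : IsLocallyFinite Φ Z I.toNonUnitalSubalgebra) {n : ℕ} {v : Fin n → A}
    (hv : IsFiniteFamily Φ Z fun i => I.projHom (v i)) : IsFiniteFamily Φ Z v :=
  IsFiniteFamily.of_extension htwo hhom hadm hA I.projHom hv fun r t ht =>
    isLocallyFinite_subalgebra_iff.1 hI r t fun i => AlgIdeal.proj_eq_zero.1 (ht i)

/-- Modulo `J`, a family in the sum of the ideals coincides with a family from `I`, so the sum is an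
extension of `J` by an image of `I`. -/
theorem exists_sup_isLocallyFinite (hA : InVariety E A) {I J : AlgIdeal Φ A}
    (hI : IsLocallyFinite Φ Z I.toNonUnitalSubalgebra)
    (hJ : IsLocallyFinite Φ Z J.toNonUnitalSubalgebra) :
    ∃ K : AlgIdeal Φ A, IsLocallyFinite Φ Z K.toNonUnitalSubalgebra ∧
      I.toNonUnitalSubalgebra ≤ K.toNonUnitalSubalgebra ∧
      J.toNonUnitalSubalgebra ≤ K.toNonUnitalSubalgebra := by
  let I' := I.toNonUnitalSubalgebra.toSubmodule
  let J' := J.toNonUnitalSubalgebra.toSubmodule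
  refine ⟨AlgIdeal.ofSubmodule (I' ⊔ J') ?_ ?_, ?_, ?_, ?_⟩
  · intro a x hx
    obtain ⟨y, hy, z, hz, rfl⟩ := Submodule.mem_sup.1 hx
    rw [mul_add]
    exact Submodule.add_mem_sup (I.mul_mem_left a y hy) (J.mul_mem_left a z hz)
  · intro x a hx
    obtain ⟨y, hy, z, hz, rfl⟩ := Submodule.mem_sup.1 hx
    rw [add_mul]
    exact Submodule.add_mem_sup (I.mul_mem_right y a hy) (J.mul_mem_right z a hz)
  · rw [isLocallyFinite_subalgebra_iff]
    intro n v hv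
    choose y hy z hz hyz using fun i => Submodule.mem_sup.1 (hv i)
    refine IsLocallyFinite.of_extension htwo hhom hadm hA hJ ?_
    have e : (fun i => J.projHom (v i)) = fun i => J.projHom (y i) := by
      funext i
      rw [← hyz, map_add, AlgIdeal.projHom_apply J (z i), AlgIdeal.proj_eq_zero.2 (hz i), add_zero]
    rw [e]
    exact (isLocallyFinite_subalgebra_iff.1 hI n y hy).map J.projHom
  · exact (le_sup_left : I' ≤ I' ⊔ J')
  · exact (le_sup_right : J' ≤ I' ⊔ J')

/-- The locally finite ideals are directed under sums, so their union is an ideal, and each finite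
family in it already lies in one of them. -/
theorem exists_greatest_isLocallyFinite (hA : InVariety E A) (Z : Ideal Φ) :
    ∃ R : AlgIdeal Φ A, IsLocallyFinite Φ Z R.toNonUnitalSubalgebra ∧
      ∀ I : AlgIdeal Φ A, IsLocallyFinite Φ Z I.toNonUnitalSubalgebra →
        I.toNonUnitalSubalgebra ≤ R.toNonUnitalSubalgebra := by
  let zero : AlgIdeal Φ A := AlgIdeal.ofSubmodule ⊥
    (fun a x hx => by rw [(Submodule.mem_bot Φ).1 hx, mul_zero]; exact zero_mem _)
    (fun x a hx => by rw [(Submodule.mem_bot Φ).1 hx, zero_mul]; exact zero_mem _)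
  have hzero : IsLocallyFinite Φ Z zero.toNonUnitalSubalgebra := by
    rw [isLocallyFinite_subalgebra_iff]
    intro n v hv
    refine ⟨0, 0, fun w _ => ?_⟩
    have : FreeMagma.lift v w = 0 := by
      induction w with
      | ih1 x => exact (Submodule.mem_bot Φ).1 (hv x)
      | ih2 x y hx _ => rw [map_mul, hx (Nat.zero_le _), zero_mul]
    rw [this]
    exact zero_mem _
  let N : Submodule Φ A :=
    { carrier := {x | ∃ I : AlgIdeal Φ A, IsLocallyFinite Φ Z I.toNonUnitalSubalgebra ∧
        x ∈ I.toNonUnitalSubalgebra}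
      add_mem' := by
        rintro x y ⟨I, hI, hx⟩ ⟨J, hJ, hy⟩
        obtain ⟨K, hK, h1, h2⟩ := exists_sup_isLocallyFinite htwo hhom hadm hA hI hJ
        exact ⟨K, hK, add_mem (h1 hx) (h2 hy)⟩
      zero_mem' := ⟨zero, hzero, zero_mem _⟩
      smul_mem' := by
        rintro c x ⟨I, hI, hx⟩
        exact ⟨I, hI, SMulMemClass.smul_mem c hx⟩ }
  have hN : ∀ (n : ℕ) (v : Fin n → A), (∀ i, v i ∈ N) → ∃ I : AlgIdeal Φ A,
      IsLocallyFinite Φ Z I.toNonUnitalSubalgebra ∧ ∀ i, v i ∈ I.toNonUnitalSubalgebra := by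
    intro n
    induction n with
    | zero => exact fun v _ => ⟨zero, hzero, fun i => i.elim0⟩
    | succ n ih =>
      intro v hv
      obtain ⟨I, hI, h1⟩ := ih (fun i => v i.succ) fun i => hv _
      obtain ⟨J, hJ, h2⟩ := hv 0
      obtain ⟨K, hK, hIK, hJK⟩ := exists_sup_isLocallyFinite htwo hhom hadm hA hI hJ
      exact ⟨K, hK, Fin.cases (hJK h2) fun i => hIK (h1 i)⟩
  refine ⟨AlgIdeal.ofSubmodule N ?_ ?_, ?_, fun I hI x hx => ⟨I, hI, hx⟩⟩
  · rintro a x ⟨I, hI, hx⟩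
    exact ⟨I, hI, I.mul_mem_left a x hx⟩
  · rintro x a ⟨I, hI, hx⟩
    exact ⟨I, hI, I.mul_mem_right x a hx⟩
  · rw [isLocallyFinite_subalgebra_iff]
    intro n v hv
    obtain ⟨I, hI, h⟩ := hN n v hv
    exact isLocallyFinite_subalgebra_iff.1 hI n v h

theorem radicalExists_isLocallyFinite (Z : Ideal Φ) :
    RadicalExists E (fun A _ _ _ _ => IsLocallyFinite Φ Z A) := by
  refine ⟨fun A _ _ _ _ B _ _ _ _ π _ hπ h => h.of_surjective π hπ, fun A _ _ _ _ hA => ?_⟩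
  obtain ⟨R, hR, hmax⟩ := exists_greatest_isLocallyFinite htwo hhom hadm hA Z
  refine ⟨R, hR, hmax, fun J hJ => ?_⟩
  -- The preimage of `J` is an extension of `R` by `J`, hence locally finite and contained in `R` by
  -- maximality.
  let K : AlgIdeal Φ A := AlgIdeal.ofSubmodule (J.toNonUnitalSubalgebra.toSubmodule.comap R.proj)
    (fun a x hx => by
      change R.proj (a * x) ∈ J.toNonUnitalSubalgebra
      rw [R.proj_mul]
      exact J.mul_mem_left _ _ hx)
    (fun x a hx => by
      change R.proj (x * a) ∈ J.toNonUnitalSubalgebra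
      rw [R.proj_mul]
      exact J.mul_mem_right _ _ hx)
  have hK : IsLocallyFinite Φ Z K.toNonUnitalSubalgebra := by
    rw [isLocallyFinite_subalgebra_iff]
    intro n v hv
    exact IsLocallyFinite.of_extension htwo hhom hadm hA hR
      (isLocallyFinite_subalgebra_iff.1 hJ n (fun i => R.projHom (v i)) hv)
  rw [eq_bot_iff]
  intro x hx
  obtain ⟨a, rfl⟩ := R.proj_surjective x
  have ha : a ∈ R.toNonUnitalSubalgebra := hmax K hK hx
  rw [AlgIdeal.proj_eq_zero.2 ha]
  exact zero_mem _

end Radical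

end ShirshovRadical

theorem theorem3p1 {Φ : Type u} [CommRing Φ] (htwo : IsUnit (2 : Φ))
    (E : Set (FreeNonUnitalNonAssocAlgebra Φ ℕ))
    (hhom : ShirshovRadical.IsHomogeneousVariety E)
    (hadm : ShirshovRadical.IsLocallyAdmissible E) :
    (∀ Z : Ideal Φ, ShirshovRadical.RadicalExists E
      (fun A _ _ _ _ => ShirshovRadical.IsLocallyFiniteOver Φ A Z)) ∧
    ShirshovRadical.RadicalExists E
      (fun A _ _ _ _ => ShirshovRadical.IsLocallyNilpotentAlg Φ A) ∧
    ShirshovRadical.RadicalExists E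
      (fun A _ _ _ _ => ShirshovRadical.IsLocallyFiniteAlg Φ A) := by
  simp only [ShirshovRadical.isLocallyFiniteOver_iff, ShirshovRadical.isLocallyNilpotentAlg_iff,
    ShirshovRadical.isLocallyFiniteAlg_iff]
  have h := ShirshovRadical.radicalExists_isLocallyFinite htwo hhom hadm
  exact ⟨h, h ⊥, h ⊤⟩
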